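/- **Theorem 4.3 (second binary Darboux transformation).** *Notation.* Functions of $(x,t)\in\mathbb R\times T$, with $T\subseteq\mathbb R$ open, are $C^\infty$ with values in $\mathbb K=\mathbb R$ or $\mathbb C$; constants lie in $\mathbb K$; $\partial=\partial/\partial x$ and $(\partial^{-1}g)(x,t)=\int_{-\infty}^x g(y,t)\,dy$. Define differential polynomials $b_k$ in $u$ by $b_0=0$, $b_1=1$, $b_{k+1}=Lb_k$ $(k\ge1)$, where $L=-\tfrac14\partial^2-u+\tfrac12\partial^{-1}u_x$ and, in $L$ only, $\partial^{-1}$ is the formal inverse of $\partial$ on differential polynomials without constant term (so $b_2=-\tfrac12u$, $b_3=\tfrac18(u_{xx}+3u^2)$). Put $a_k=-\tfrac12\partial b_k$ and $$A^{(n)}(u,\lambda)=\sum_{i=0}^{n+1}\bigl(a_i[u]+b_i[u]\,\partial\bigr)\lambda^{n+1-i}.$$ For $n,N\ge 0$ and a constant $\alpha$, the $n$-th KdV equation with $N$ self-consistent sources is $$u_t=\partial\Bigl[-2b_{n+2}[u]-2\alpha\sum_{j=1}^N\phi_j^2\Bigr],\qquad \phi_{j,xx}+(\lambda_j+u)\phi_j=0\quad(1\le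 j\le N),\tag{1}$$ and its Lax pair with parameters $\lambda,\eta$ is $$\psi_{xx}+(\lambda+u)\psi=0,\qquad \psi_t=A^{(n)}(u,\lambda)\psi+\eta\psi+\alpha\sum_{j=1}^N\phi_j\,\partial^{-1}(\phi_j\psi).\tag{2}$$ A product $pq$ is said to decay at $-\infty$ if, locally uniformly in $t\in T$, the functions $pq,\ p_xq,\ pq_x,\ p_xq_x$ are dominated on $x\le 0$ by an integrable function of $x$ tending to $0$ as $x\to-\infty$. A solution $\psi$ of (2) is always understood to be such that all products $\phi_j\psi$, $1\le j\le N$, decay at $-\infty$. *Statement.* Let $\lambda_1,\dots,\lambda_{N+1}$ be distinct and let $u,\phi_1,\dots,\phi_N$ be a solution of (1), where all $x$-derivatives $\partial^k u$, $k\ge 0$, are bounded on $x\le 0$, locally uniformly in $t$. Let $f_1=\phi_{N+1}$ solve (2) with $\lambda=\lambda_{N+1}$ and $\eta=-\tfrac12\alpha$, let $f_1^2$ decay at $-\infty$, and let $1+\partial^{-1}f_1^2$ have no zero on $\mathbb R\times T$ (automatic if $\mathbb K=\mathbb R$). Put $$\bar\phi_{N+1}=\frac{f_1}{1+\partial^{-1}f_1^2},\qquad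 \bar\phi_j=\phi_j-\bar\phi_{N+1}\,\partial^{-1}(f_1\phi_j)\ \ (1\le j\le N),\qquad \bar u=u+2\partial^2\ln\bigl(1+\partial^{-1}f_1^2\bigr),$$ where $\partial^2\ln w$ means $\partial(w_x/w)$. Then: 1. For every $\lambda$ and every solution $\psi$ of (2) with this $\lambda$ and $\eta=-\tfrac12\alpha$ for which $f_1\psi$ decays at $-\infty$, the function $\bar\psi=\psi-\bar\phi_{N+1}\,\partial^{-1}(f_1\psi)$ is smooth, all products $\bar\phi_j\bar\psi$ $(1\le j\le N+1)$ decay at $-\infty$, and $$\bar\psi_{xx}+(\lambda+\bar u)\bar\psi=0,\qquad \bar\psi_t=A^{(n)}(\bar u,\lambda)\bar\psi-\tfrac12\alpha\bar\psi+\alpha\sum_{j=1}^{N+1}\bar\phi_j\,\partial^{-1}(\bar\phi_j\bar\psi).$$ 2. $\bar u,\bar\phi_1,\dots,\bar\phi_{N+1}$ are smooth and solve the $n$-th KdV equation with $N+1$ self-consistent sources, $$\bar u_t=\partial\Bigl[-2b_{n+2}[\bar u]-2\alpha\sum_{j=1}^{N+1}\bar\phi_j^2\Bigr],\qquad \bar\phi_{j,xx}+(\lambda_j+\bar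 u)\bar\phi_j=0\quad(1\le j\le N+1),$$ and all $x$-derivatives of $\bar u$ are bounded on $x\le0$, locally uniformly in $t$. So the map $(u,\phi_1,\dots,\phi_N)\mapsto(\bar u,\bar\phi_1,\dots,\bar\phi_{N+1})$ is a non-auto-Bäcklund transformation. -/

import Mathlib

open Set Filter Topology
open scoped ContDiff

noncomputable section

namespace KdVSources

/-! ### Differential polynomials and the coefficients of the KdV hierarchy -/

/-- Differential polynomials in one function `u`: the variable `X i` stands for `∂ⁱu/∂xⁱ`. -/
abbrev DiffPoly : Type := MvPolynomial ℕ ℚ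

/-- The total `x`-derivative `∂` on differential polynomials, `∂ u⁽ⁱ⁾ = u⁽ⁱ⁺¹⁾`. -/
def totalD : Derivation ℚ DiffPoly DiffPoly :=
  MvPolynomial.mkDerivation ℚ (fun i => MvPolynomial.X (i + 1))

open Classical in
/-- The formal inverse `∂⁻¹` on differential polynomials: the antiderivative without constant
term (and `0` when there is no antiderivative among the differential polynomials). -/
def formalInt (p : DiffPoly) : DiffPoly :=
  if h : ∃ q : DiffPoly, totalD q = p ∧ MvPolynomial.constantCoeff q = 0 then h.choose else 0

/-- The recursion operator `L = -¼ ∂² - u + ½ ∂⁻¹ u_x`. -/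
def recursionL (p : DiffPoly) : DiffPoly :=
  -(1 / 4 : ℚ) • totalD (totalD p) - MvPolynomial.X 0 * p
    + (1 / 2 : ℚ) • formalInt (MvPolynomial.X 1 * p)

/-- The differential polynomials `b_k`: `b_0 = 0`, `b_1 = 1`, `b_{k+1} = L b_k` for `k ≥ 1`. -/
def bCoeff : ℕ → DiffPoly
  | 0 => 0
  | 1 => 1
  | k + 2 => recursionL (bCoeff (k + 1))

/-- The differential polynomials `a_k = -½ ∂ b_k`. -/
def aCoeff (k : ℕ) : DiffPoly := -(1 / 2 : ℚ) • totalD (bCoeff k)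

variable {𝕜 : Type*} [RCLike 𝕜]

/-- The value `P[u](x, t)` of a differential polynomial at a function `u(x, t)`. -/
def evalDiff (P : DiffPoly) (u : ℝ → ℝ → 𝕜) (x t : ℝ) : 𝕜 :=
  MvPolynomial.aeval (fun i : ℕ => iteratedDeriv i (fun y => u y t) x) P

/-! ### Derivatives and integrals of functions of `(x, t)` -/

/-- `∂/∂x`. -/
def dx (g : ℝ → ℝ → 𝕜) (x t : ℝ) : 𝕜 := deriv (fun y => g y t) x

/-- `∂/∂t`. -/
def dt (g : ℝ → ℝ → 𝕜) (x t : ℝ) : 𝕜 := deriv (fun s => g x s) t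

/-- `(∂⁻¹ g)(x, t) = ∫_{-∞}^x g(y, t) dy`. -/
def intX (g : ℝ → ℝ → 𝕜) (x t : ℝ) : 𝕜 := ∫ y in Iic x, g y t

/-- `g` is smooth in `(x, t)` on `ℝ × T`. -/
def SmoothOn (T : Set ℝ) (g : ℝ → ℝ → 𝕜) : Prop :=
  ContDiffOn ℝ ∞ (fun z : ℝ × ℝ => g z.1 z.2) (univ ×ˢ T)

/-- All `x`-derivatives of `u` stay bounded as `x → -∞`, locally uniformly in `t ∈ T`. -/
def BoundedAtNegInf (T : Set ℝ) (u : ℝ → ℝ → 𝕜) : Prop :=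
  ∀ k : ℕ, ∀ t₀ ∈ T, ∃ V ∈ 𝓝 t₀, ∃ C : ℝ, ∀ t ∈ V, ∀ x ≤ 0,
    ‖iteratedDeriv k (fun y => u y t) x‖ ≤ C

/-- The product `p q` decays as `x → -∞`: locally uniformly in `t ∈ T`, the products
`p q`, `p_x q`, `p q_x`, `p_x q_x` are dominated on `(-∞, 0]` by an integrable function that
tends to `0` at `-∞`. -/
def ProductDecays (T : Set ℝ) (p q : ℝ → ℝ → 𝕜) : Prop :=
  ∀ t₀ ∈ T, ∃ V ∈ 𝓝 t₀, ∃ G : ℝ → ℝ,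
    MeasureTheory.IntegrableOn G (Iic 0) ∧ Tendsto G atBot (𝓝 0) ∧
    ∀ t ∈ V, ∀ x ≤ 0,
      ‖p x t * q x t‖ ≤ G x ∧ ‖dx p x t * q x t‖ ≤ G x ∧
      ‖p x t * dx q x t‖ ≤ G x ∧ ‖dx p x t * dx q x t‖ ≤ G x

/-! ### The hierarchy with self-consistent sources and its Lax pair -/

/-- `A⁽ⁿ⁾(u, lam) ψ = ∑_{i=0}^{n+1} (a_i[u] ψ + b_i[u] ψ_x) lam^{n+1-i}`. -/
def laxA (n : ℕ) (u : ℝ → ℝ → 𝕜) (lam : 𝕜) (ψ : ℝ → ℝ → 𝕜) (x t : ℝ) : 𝕜 :=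
  ∑ i ∈ Finset.range (n + 2),
    (evalDiff (aCoeff i) u x t * ψ x t + evalDiff (bCoeff i) u x t * dx ψ x t)
      * lam ^ (n + 1 - i)

/-- `(u, φ_1, …, φ_N)` is a smooth solution, for `t ∈ T`, of the `n`-th KdV equation with `N`
self-consistent sources:
`u_t = ∂[-2 b_{n+2}[u] - 2 α ∑ φ_j²]`, `φ_{j,xx} + (lam_j + u) φ_j = 0`. -/
structure IsSourceSolution (n N : ℕ) (α : 𝕜) (T : Set ℝ) (lam : Fin N → 𝕜)
    (u : ℝ → ℝ → 𝕜) (φ : Fin N → ℝ → ℝ → 𝕜) : Prop where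
  smooth_u : SmoothOn T u
  smooth_φ : ∀ j, SmoothOn T (φ j)
  evolution : ∀ x, ∀ t ∈ T, dt u x t =
    dx (fun y s => -2 * evalDiff (bCoeff (n + 2)) u y s - 2 * α * ∑ j, φ j y s ^ 2) x t
  spectral : ∀ j x, ∀ t ∈ T, dx (dx (φ j)) x t + (lam j + u x t) * φ j x t = 0

/-- `ψ` is a smooth solution, for `t ∈ T`, of the Lax pair with spectral parameter `lam` and
sources `φ_1, …, φ_N`, all products `φ_j ψ` decaying at `x = -∞`:
`ψ_xx + (lam + u) ψ = 0`, `ψ_t = A⁽ⁿ⁾(u, lam) ψ + η ψ + α ∑ φ_j ∂⁻¹(φ_j ψ)`. -/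
structure IsLaxSolution (n N : ℕ) (α η : 𝕜) (T : Set ℝ) (u : ℝ → ℝ → 𝕜)
    (φ : Fin N → ℝ → ℝ → 𝕜) (lam : 𝕜) (ψ : ℝ → ℝ → 𝕜) : Prop where
  smooth : SmoothOn T ψ
  decay : ∀ j, ProductDecays T (φ j) ψ
  spectral : ∀ x, ∀ t ∈ T, dx (dx ψ) x t + (lam + u x t) * ψ x t = 0
  evolution : ∀ x, ∀ t ∈ T, dt ψ x t =
    laxA n u lam ψ x t + η * ψ x t
      + α * ∑ j, φ j x t * intX (fun y s => φ j y s * ψ y s) x t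

/-! ### The second binary Darboux transformation -/

/-- `1 + ∂⁻¹ f²`. -/
def tau (f : ℝ → ℝ → 𝕜) (x t : ℝ) : 𝕜 := 1 + intX (fun y s => f y s ^ 2) x t

/-- `ψ ↦ ψ - f / (1 + ∂⁻¹ f²) · ∂⁻¹(f ψ)`. -/
def darbouxWave (f ψ : ℝ → ℝ → 𝕜) (x t : ℝ) : 𝕜 :=
  ψ x t - f x t / tau f x t * intX (fun y s => f y s * ψ y s) x t

/-- `u ↦ u + 2 ∂² ln (1 + ∂⁻¹ f²)`, where `∂² ln τ` is the `x`-derivative of the logarithmic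
derivative `τ_x / τ`, so that no branch of the logarithm has to be chosen for complex `τ`. -/
def darbouxPotential (u f : ℝ → ℝ → 𝕜) (x t : ℝ) : 𝕜 :=
  u x t + 2 * deriv (logDeriv (fun y => tau f y t)) x

/-- The transformed sources: `φ_j - f / (1 + ∂⁻¹ f²) · ∂⁻¹(f φ_j)` for `j = 1, …, N`, and
`f / (1 + ∂⁻¹ f²)` as the source number `N + 1`. -/
def darbouxSources {N : ℕ} (f : ℝ → ℝ → 𝕜) (φ : Fin N → ℝ → ℝ → 𝕜) :
    Fin (N + 1) → ℝ → ℝ → 𝕜 :=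
  Fin.snoc (α := fun _ => ℝ → ℝ → 𝕜) (fun j => darbouxWave f (φ j))
    (fun x t => f x t / tau f x t)

end KdVSources

end

open KdVSources

/-!
The proof separates algebra in `x`, the behaviour at `x = -∞`, and the time dependence.

Write `τ = 1 + ∂⁻¹ f²`, `s = ∂⁻¹(f ψ)` and let a bar denote the transform. The coefficients `b_k` are
local (`totalD_bCoeff_succ`): `∂ b_{k+1} = R b_k` with `R = -¼ ∂³ - u ∂ - ½ u_x`, because `R` is
skew-adjoint modulo exact differential polynomials. Hence, for solutions `f`, `ψ` of the Schrödinger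
equations with parameters `κ`, `μ`, the expression `A(κ)f · ψ + f · A(μ)ψ` is the `x`-derivative of
a flux `Q[f, ψ]` that is bilinear in `(f, f_x)` and `(ψ, ψ_x)` (`fluxSeq_deriv`).

Two identities carry the argument. The first is `b_{n+2}[ū] = b_{n+2}[u] - ∂(Q⁽ⁿ⁾[f, f] / τ)`
(`halfB_transformed`): both sides satisfy the recursion `∂ b_{k+1} = R b_k` for the potential `ū`
(`transformed_recursion`), which leaves only a function of `t` undetermined at each step, and their
difference tends to `0` at `-∞`. The second, which follows from the first by induction on `n`,
expresses `A(ū)ψ̄` by `A(u)ψ`, `A(u)f`, `Q[f, f]` and `Q[f, ψ]` (`laxSeq_transformed`). The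
computations behind them are made in an arbitrary differential algebra and applied in the algebra
`SliceSmooth` of functions of `(x, t)` that are smooth in `x`.

In time, `(f ψ)_t` is the `x`-derivative of `Q[f, ψ] - α s + α ∑ ∂⁻¹(φ_j f) ∂⁻¹(φ_j ψ)`, which tends
to `0` at `-∞` locally uniformly in `t`, and so is equal to `s_t` (`hasDerivAt_intX_time`). Inserting
this into the time derivatives of `ψ̄` and of `ū` leaves exactly the two identities above, the source
terms being accounted for by `∂⁻¹(p̄ q̄) = ∂⁻¹(p q) - ∂⁻¹(f p) ∂⁻¹(f q) / τ`.

Smoothness of `s` in `(x, t)` uses that the parameters `λ_j` are distinct (`smoothOn_intX`): if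
`μ ≠ κ`, then `(μ - κ) s` is the Wronskian of `f` and `ψ`; if `μ = κ`, then the `∂⁻¹(φ_j f)` and
`∂⁻¹(φ_j ψ)` are Wronskians up to constants, so that `s_t + α s` is smooth.
-/

open Set Filter Topology
open scoped ContDiff

noncomputable section

namespace KdVSources

/-! ### Locality of the KdV hierarchy -/

section

open MvPolynomial

/-- The exact differential polynomials: those that are total `x`-derivatives. -/
def exactSubmodule : Submodule ℚ DiffPoly := LinearMap.range totalD.toLinearMap

lemma mem_exactSubmodule {p : DiffPoly} : p ∈ exactSubmodule ↔ ∃ q, totalD q = p := Iff.rfl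

lemma totalD_formalInt {p : DiffPoly} (hp : p ∈ exactSubmodule) : totalD (formalInt p) = p := by
  obtain ⟨q, hq⟩ := mem_exactSubmodule.1 hp
  -- subtracting the constant term does not change the total derivative
  have h : ∃ q : DiffPoly, totalD q = p ∧ MvPolynomial.constantCoeff q = 0 := by
    refine ⟨q - C (constantCoeff q), ?_, by simp⟩
    rw [map_sub, hq,
      show (C (constantCoeff q) : DiffPoly) = algebraMap ℚ _ (constantCoeff q) from rfl,
      Derivation.map_algebraMap, sub_zero]
  rw [formalInt, dif_pos h]
  exact h.choose_spec.1

/-- The third-order operator `R = ∂ L = -¼ ∂³ - u ∂ - ½ u_x`, which is skew-adjoint modulo exact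
differential polynomials. -/
def skewR (p : DiffPoly) : DiffPoly :=
  -(1 / 4 : ℚ) • totalD (totalD (totalD p)) - X 0 * totalD p - (1 / 2 : ℚ) • (X 1 * p)

lemma totalD_X (i : ℕ) : totalD (X i) = X (i + 1) := mkDerivation_X _ _ _

lemma skewR_skew (p q : DiffPoly) : p * skewR q + q * skewR p ∈ exactSubmodule := by
  refine mem_exactSubmodule.2
    ⟨-(1 / 4 : ℚ) • (p * totalD (totalD q) - totalD p * totalD q + totalD (totalD p) * q)
      - X 0 * (p * q), ?_⟩
  simp only [skewR, map_sub, map_add, Derivation.map_smul, map_neg, neg_smul, Derivation.leibniz,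
    smul_eq_mul, totalD_X]
  simp only [smul_eq_C_mul, mul_add, mul_sub, mul_neg]
  have h2 : (C (1 / 2 : ℚ) : DiffPoly) * 2 = 1 := by
    rw [show (2 : DiffPoly) = C 2 from (map_ofNat C 2).symm, ← C_mul]; norm_num
  linear_combination (X 1 * p * q) * h2

lemma totalD_recursionL {p : DiffPoly} (hp : X 1 * p ∈ exactSubmodule) :
    totalD (recursionL p) = skewR p := by
  simp only [recursionL, skewR, map_add, map_sub, Derivation.map_smul, map_neg, neg_smul,
    Derivation.leibniz, smul_eq_mul, totalD_X, totalD_formalInt hp, zero_add]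
  have h2 : (C (1 / 2 : ℚ) : DiffPoly) * 2 = 1 := by
    rw [show (2 : DiffPoly) = C 2 from (map_ofNat C 2).symm, ← C_mul]; norm_num
  simp only [smul_eq_C_mul]
  linear_combination ((X 1) * p) * h2

/-- The locality of the KdV hierarchy: if the recursion `∂ b_{j+1} = R b_j` holds for `j < k`,
then `u_x b_k` is exact. Modulo exact terms, `b_i R b_j ≡ b_{i-1} R b_{j+1}`, so that
`b_k R b_1 ≡ b_1 R b_k ≡ -b_k R b_1`, and `R b_1 = -½ u_x`. -/
lemma X_one_mul_bCoeff_exact {k : ℕ}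
    (h : ∀ j < k, totalD (bCoeff (j + 1)) = skewR (bCoeff j)) :
    X 1 * bCoeff k ∈ exactSubmodule := by
  have key : ∀ i < k, bCoeff k * skewR (bCoeff 1)
      - bCoeff (k - i) * skewR (bCoeff (1 + i)) ∈ exactSubmodule := by
    intro i
    induction i with
    | zero => intro _; simp
    | succ i ih =>
      intro hi
      obtain ⟨m, hm⟩ : ∃ m, k = m + 1 + (i + 1) := ⟨k - (i + 2), by omega⟩
      have h0 := ih (by omega)
      have e1 : k - i = m + 1 + 1 := by omega
      have e2 : k - (i + 1) = m + 1 := by omega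
      rw [e1] at h0
      rw [e2]
      have h1 := skewR_skew (bCoeff (m + 1)) (bCoeff (1 + i + 1))
      have h2 : bCoeff (m + 1 + 1) * totalD (bCoeff (1 + i + 1))
          + bCoeff (1 + i + 1) * totalD (bCoeff (m + 1 + 1)) ∈ exactSubmodule :=
        mem_exactSubmodule.2 ⟨bCoeff (m + 1 + 1) * bCoeff (1 + i + 1), by
          simp only [Derivation.leibniz, smul_eq_mul]⟩
      rw [h (1 + i) (by omega), h (m + 1) (by omega)] at h2
      have := sub_mem (add_mem h0 h2) h1
      convert this using 1
      rw [show 1 + (i + 1) = 1 + i + 1 by ring]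
      ring
  rcases k with _ | k
  · simp [bCoeff]
  have h0 := add_mem (key k (by omega)) (skewR_skew (bCoeff (k + 1)) (bCoeff 1))
  have e : k + 1 - k = 1 := by omega
  have hR : skewR (bCoeff 1) = -(1 / 2 : ℚ) • X 1 := by
    simp [skewR, bCoeff]
  rw [e, show 1 + k = k + 1 by ring, hR] at h0
  have h1 := exactSubmodule.smul_mem (-1 : ℚ) h0
  convert h1 using 1
  have h2 : (C (1 / 2 : ℚ) : DiffPoly) * 2 = 1 := by
    rw [show (2 : DiffPoly) = C 2 from (map_ofNat C 2).symm, ← C_mul]; norm_num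
  simp only [smul_eq_C_mul, neg_smul, C_1]
  linear_combination (-(X 1) * bCoeff (k + 1)) * h2

theorem totalD_bCoeff_succ (k : ℕ) : totalD (bCoeff (k + 1)) = skewR (bCoeff k) := by
  induction k using Nat.strong_induction_on with
  | _ k ih =>
    rcases k with _ | k
    · simp [skewR, bCoeff]
    · exact totalD_recursionL (X_one_mul_bCoeff_exact fun j hj => ih j hj)

end

/-! ### The transformation in a differential algebra -/

section DifferentialAlgebra

variable {K S : Type*} [CommRing K] [CommRing S] [Algebra K S] (D : Derivation K S S)

/-- `A⁽ᵐ⁻¹⁾(u, l) ψ` in a differential algebra, for `c = b / 2`, built up one power of the spectral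
parameter `l` at a time. -/
def laxSeq (c : ℕ → S) (l ψ : S) : ℕ → S
  | 0 => 0
  | m + 1 => l * laxSeq c l ψ m + (2 * c (m + 1) * D ψ - D (c (m + 1)) * ψ)

/-- The flux `∂⁻¹(A(k)f · ψ + f · A(l)ψ)`, where `f` and `ψ` belong to the spectral parameters `k`
and `l`, as a bilinear form in `(f, f_x)` and `(ψ, ψ_x)`. -/
def fluxSeq (c : ℕ → S) (k f l ψ : S) : ℕ → S
  | 0 => 0
  | m + 1 => l * fluxSeq c k f l ψ m
      + (D ψ * laxSeq D c k f m - ψ * D (laxSeq D c k f m) + 2 * c (m + 1) * f * ψ)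

variable {D} {c : ℕ → S} {u : S}

/-- `A ψ` satisfies the linearized Schrödinger equation, with the flow `-2 ∂b_{m+1} = -4 ∂c_{m+1}`
of the potential as its inhomogeneity. -/
lemma laxSeq_deriv_deriv {l ψ : S} (hc0 : c 0 = 0)
    (hc : ∀ k, 4 * D (c (k + 1)) = -(D (D (D (c k))) + 4 * u * D (c k) + 2 * D u * c k))
    (hl : D l = 0) (hψ : D (D ψ) = -(l + u) * ψ) (m : ℕ) :
    D (D (laxSeq D c l ψ m)) = -(l + u) * laxSeq D c l ψ m + 4 * D (c (m + 1)) * ψ := by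
  have h2 : D (2 : S) = 0 := D.map_natCast 2
  induction m with
  | zero =>
    have h1 : 4 * D (c 1) = 0 := by simpa [hc0] using hc 0
    simp [laxSeq, h1]
  | succ m ih =>
    simp only [laxSeq, Derivation.leibniz, map_add, map_sub, map_neg, map_zero, hl, h2, hψ,
      smul_eq_mul, ih]
    linear_combination (-ψ) * hc (m + 1)

lemma fluxSeq_deriv {k f l ψ : S} (hc0 : c 0 = 0)
    (hc : ∀ k, 4 * D (c (k + 1)) = -(D (D (D (c k))) + 4 * u * D (c k) + 2 * D u * c k))
    (hk : D k = 0) (hf : D (D f) = -(k + u) * f) (hl : D l = 0)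
    (hψ : D (D ψ) = -(l + u) * ψ) (m : ℕ) :
    D (fluxSeq D c k f l ψ m) = laxSeq D c k f m * ψ + f * laxSeq D c l ψ m := by
  have h2 : D (2 : S) = 0 := D.map_natCast 2
  induction m with
  | zero => simp [fluxSeq, laxSeq]
  | succ m ih =>
    have hA := laxSeq_deriv_deriv hc0 hc hk hf m
    simp only [fluxSeq, Derivation.leibniz, map_add, map_sub, hl, h2, hψ, smul_eq_mul, ih, hA]
    simp only [laxSeq]
    ring

/-- With `I = 1 / τ`, `τ_x = f²`, the sequence `b_{m+1} - ∂(Q_m / τ)` obeys the recursion relation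
of the KdV hierarchy for the transformed potential `u + 2 ∂(f² / τ)`. -/
lemma transformed_recursion {k f I : S} (hc0 : c 0 = 0)
    (hc : ∀ k, 4 * D (c (k + 1)) = -(D (D (D (c k))) + 4 * u * D (c k) + 2 * D u * c k))
    (hk : D k = 0) (hf : D (D f) = -(k + u) * f) (hI : D I = -(f ^ 2 * I ^ 2))
    {e : ℕ → S} (he : ∀ m, e m = 2 * c (m + 1) - D (fluxSeq D c k f k f m * I))
    {v : S} (hv : v = u + 2 * D (f ^ 2 * I)) (m : ℕ) :
    4 * D (e (m + 1)) = -(D (D (D (e m))) + 4 * v * D (e m) + 2 * D v * e m) := by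
  have h2 : D (2 : S) = 0 := D.map_natCast 2
  have h4 : D (4 : S) = 0 := D.map_natCast 4
  have hA := laxSeq_deriv_deriv hc0 hc hk hf m
  have hQ := fluxSeq_deriv hc0 hc hk hf hk hf m
  have hQ' := fluxSeq_deriv hc0 hc hk hf hk hf (m + 1)
  have hcm := hc (m + 1)
  rw [hv, he, he]
  simp only [fluxSeq, laxSeq] at hQ' ⊢
  set A := laxSeq D c k f m with hAdef
  set Q := fluxSeq D c k f k f m with hQdef
  simp only [pow_two, Derivation.leibniz, map_add, map_sub, map_neg, map_zero, hk, h2, h4,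
    hf, hQ, hA, hI, smul_eq_mul]
  linear_combination 2 * hcm

/-- The wave function transformed by the binary Darboux transformation is mapped by the transformed
operator `A` to the transform of `A ψ`, up to the terms that the time derivatives of
`τ = 1 / I` and `s = ∂⁻¹(f ψ)` account for. -/
lemma laxSeq_transformed {k f I l ψ s : S} (hc0 : c 0 = 0)
    (hc : ∀ k, 4 * D (c (k + 1)) = -(D (D (D (c k))) + 4 * u * D (c k) + 2 * D u * c k))
    (hk : D k = 0) (hf : D (D f) = -(k + u) * f) (hI : D I = -(f ^ 2 * I ^ 2))
    (hs : D s = f * ψ) (hW : (l - k) * s = D f * ψ - f * D ψ)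
    {d : ℕ → S} (hd : ∀ m, 2 * d (m + 1) = 2 * c (m + 1) - D (fluxSeq D c k f k f m * I))
    (h2u : IsUnit (2 : S)) (m : ℕ) :
    laxSeq D d l (ψ - f * I * s) m = laxSeq D c l ψ m - I * s * laxSeq D c k f m
      + f * s * I ^ 2 * fluxSeq D c k f k f m - f * I * fluxSeq D c k f l ψ m := by
  have h2 : D (2 : S) = 0 := D.map_natCast 2
  induction m with
  | zero => simp [fluxSeq, laxSeq]
  | succ m ih =>
    have hA := laxSeq_deriv_deriv hc0 hc hk hf m
    have hQ := fluxSeq_deriv hc0 hc hk hf hk hf m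
    have hd1 := hd m
    have hd2 := congrArg D hd1
    simp only [fluxSeq, laxSeq, ih]
    simp only [pow_two, Derivation.leibniz, map_add, map_sub, map_neg, h2, hQ, hI, hs,
      smul_eq_mul, mul_zero, add_zero] at hd1 hd2 ⊢
    set A := laxSeq D c k f m with hAdef
    set Q := fluxSeq D c k f k f m with hQdef
    apply h2u.mul_left_cancel
    -- the first two coefficients are twice `∂` of the new wave function and minus that function, as
    -- in `2 b ∂ - ∂b`; the Wronskian relation absorbs the factors `l - k` left by the recursions
    linear_combination
      (2 * (D ψ - (D f * I * s - f * (f * f * (I * I)) * s + f * I * (f * ψ)))) * hd1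
        - (ψ - f * I * s) * hd2 - (2 * I * A - 2 * f * I ^ 2 * Q) * hW

/-- The binary Darboux transformation of the Schrödinger equation. -/
lemma schrodinger_transformed {k f I l ψ s : S}
    (hf : D (D f) = -(k + u) * f) (hI : D I = -(f ^ 2 * I ^ 2)) (hψ : D (D ψ) = -(l + u) * ψ)
    (hs : D s = f * ψ) (hW : (l - k) * s = D f * ψ - f * D ψ)
    {v : S} (hv : v = u + 2 * D (f ^ 2 * I)) :
    D (D (ψ - f * I * s)) = -(l + v) * (ψ - f * I * s) := by
  have h2 : D (2 : S) = 0 := D.map_natCast 2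
  rw [hv]
  simp only [pow_two, Derivation.leibniz, map_add, map_sub, map_neg, hf, hψ, hI, hs, smul_eq_mul]
  linear_combination (-(f * I)) * hW

end DifferentialAlgebra

/-! ### The differential algebra of functions smooth in `x` -/

section SliceSmooth

variable (𝕜 : Type*) [RCLike 𝕜]

/-- The algebra of functions of `(x, t)` that are smooth in `x` for each `t`. -/
def SliceSmooth : Subalgebra 𝕜 (ℝ → ℝ → 𝕜) where
  carrier := {g | ∀ t, ContDiff ℝ ∞ (fun x => g x t)}
  mul_mem' ha hb t := (ha t).mul (hb t)
  add_mem' ha hb t := (ha t).add (hb t)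
  algebraMap_mem' _ _ := contDiff_const

variable {𝕜}

lemma differentiableAt_slice (g : SliceSmooth 𝕜) (t x : ℝ) :
    DifferentiableAt ℝ (fun y => g.1 y t) x :=
  (g.2 t).differentiable (by simp) x

variable (𝕜) in
/-- `∂` as a derivation of the algebra of functions smooth in `x`. -/
def xDeriv : Derivation 𝕜 (SliceSmooth 𝕜) (SliceSmooth 𝕜) :=
  Derivation.mk'
    { toFun := fun g => ⟨dx g.1, fun t => (contDiff_infty_iff_deriv.1 (g.2 t)).2⟩
      map_add' := fun g h => Subtype.ext <| funext fun x => funext fun t =>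
        deriv_fun_add (differentiableAt_slice g t x) (differentiableAt_slice h t x)
      map_smul' := fun c g => Subtype.ext <| funext fun x => funext fun t =>
        deriv_const_mul c (differentiableAt_slice g t x) }
    fun g h => Subtype.ext <| funext fun x => funext fun t => by
      refine (deriv_fun_mul (differentiableAt_slice g t x) (differentiableAt_slice h t x)).trans ?_
      change _ = g.1 x t * deriv (fun y => h.1 y t) x + h.1 x t * deriv (fun y => g.1 y t) x
      ring

lemma xDeriv_apply (g : SliceSmooth 𝕜) (x t : ℝ) : (xDeriv 𝕜 g).1 x t = dx g.1 x t := rfl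

lemma hasDerivAt_slice (g : SliceSmooth 𝕜) (x t : ℝ) :
    HasDerivAt (fun y => g.1 y t) ((xDeriv 𝕜 g).1 x t) x :=
  (differentiableAt_slice g t x).hasDerivAt

lemma iterate_xDeriv_apply (g : SliceSmooth 𝕜) (k : ℕ) (x t : ℝ) :
    ((xDeriv 𝕜)^[k] g).1 x t = iteratedDeriv k (fun y => g.1 y t) x := by
  induction k generalizing g with
  | zero => rfl
  | succ k ih => rw [Function.iterate_succ_apply, ih, iteratedDeriv_succ']; rfl

lemma iterate_xDeriv_sub (g h : SliceSmooth 𝕜) (k : ℕ) :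
    (xDeriv 𝕜)^[k] (g - h) = (xDeriv 𝕜)^[k] g - (xDeriv 𝕜)^[k] h := by
  induction k generalizing g h with
  | zero => rfl
  | succ k ih => simp only [Function.iterate_succ_apply, map_sub, ih]

/-- A function with vanishing `x`-derivative that tends to `0` at `-∞` vanishes. -/
lemma eq_zero_of_xDeriv_eq_zero {g : SliceSmooth 𝕜} {t : ℝ} (hg : ∀ x, (xDeriv 𝕜 g).1 x t = 0)
    (h : Tendsto (fun x => g.1 x t) atBot (𝓝 0)) (x : ℝ) : g.1 x t = 0 := by
  have hc : ∀ y, g.1 y t = g.1 x t := fun y =>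
    is_const_of_deriv_eq_zero (fun z => differentiableAt_slice g t z) hg y x
  exact tendsto_nhds_unique (tendsto_const_nhds.congr fun y => (hc y).symm) h

/-- The restriction of a function to the times in `T`, extended by `0` to all other times.
Homogeneous identities between such functions hold trivially at the times outside `T`. -/
def restrictTime (T : Set ℝ) (g : ℝ → ℝ → 𝕜) (hg : ∀ t ∈ T, ContDiff ℝ ∞ (fun x => g x t)) :
    SliceSmooth 𝕜 := by
  classical
  exact ⟨fun x t => if t ∈ T then g x t else 0, fun t => by
    by_cases ht : t ∈ T
    · simpa [ht] using hg t ht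
    · simpa [ht] using contDiff_const⟩

lemma restrictTime_apply {T : Set ℝ} {g : ℝ → ℝ → 𝕜}
    (hg : ∀ t ∈ T, ContDiff ℝ ∞ (fun x => g x t)) {t : ℝ} (ht : t ∈ T) (x : ℝ) :
    (restrictTime T g hg).1 x t = g x t := if_pos ht

lemma restrictTime_apply_of_notMem {T : Set ℝ} {g : ℝ → ℝ → 𝕜}
    (hg : ∀ t ∈ T, ContDiff ℝ ∞ (fun x => g x t)) {t : ℝ} (ht : t ∉ T) (x : ℝ) :
    (restrictTime T g hg).1 x t = 0 := if_neg ht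

lemma SmoothOn.contDiff_slice {T : Set ℝ} {g : ℝ → ℝ → 𝕜} (hg : SmoothOn T g) {t : ℝ}
    (ht : t ∈ T) : ContDiff ℝ ∞ (fun x => g x t) :=
  hg.comp_contDiff (f := fun x : ℝ => (x, t)) (contDiff_id.prodMk contDiff_const)
    fun _ => ⟨mem_univ _, ht⟩

lemma xDeriv_eq_dx {g : ℝ → ℝ → 𝕜} {G : SliceSmooth 𝕜} {t : ℝ} (h : ∀ x, G.1 x t = g x t)
    (x : ℝ) : (xDeriv 𝕜 G).1 x t = dx g x t := by
  rw [xDeriv_apply, dx, dx, show (fun y => G.1 y t) = fun y => g y t from funext h]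

/-! ### Evaluation of differential polynomials -/

/-- The value of a differential polynomial at an element of the differential algebra. -/
def evalSlice (P : DiffPoly) (u : SliceSmooth 𝕜) : SliceSmooth 𝕜 :=
  MvPolynomial.aeval (fun i : ℕ => (xDeriv 𝕜)^[i] u) P

lemma evalSlice_C (q : ℚ) (u : SliceSmooth 𝕜) :
    evalSlice (MvPolynomial.C q) u = algebraMap 𝕜 (SliceSmooth 𝕜) (q : 𝕜) := by
  rw [evalSlice, MvPolynomial.aeval_C, ← eq_ratCast (algebraMap ℚ 𝕜), ← RingHom.comp_apply]
  exact RingHom.congr_fun (Subsingleton.elim _ _) q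

/-- Evaluation at a point, as a ring homomorphism. -/
def evalAt (x t : ℝ) : SliceSmooth 𝕜 →+* 𝕜 where
  toFun g := g.1 x t
  map_one' := rfl
  map_mul' _ _ := rfl
  map_zero' := rfl
  map_add' _ _ := rfl

lemma evalSlice_apply {u : SliceSmooth 𝕜} {v : ℝ → ℝ → 𝕜} {t : ℝ} (h : ∀ x, u.1 x t = v x t)
    (P : DiffPoly) (x : ℝ) : (evalSlice P u).1 x t = evalDiff P v x t := by
  have h1 : ∀ i, ((xDeriv 𝕜)^[i] u).1 x t = iteratedDeriv i (fun y => v y t) x := fun i => by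
    rw [iterate_xDeriv_apply, show (fun y => u.1 y t) = fun y => v y t from funext h]
  change evalAt x t (MvPolynomial.aeval _ P) = _
  rw [MvPolynomial.map_aeval, evalDiff, MvPolynomial.aeval_def, MvPolynomial.coe_eval₂Hom,
    Subsingleton.elim ((evalAt x t).comp (algebraMap ℚ (SliceSmooth 𝕜))) (algebraMap ℚ 𝕜)]
  congr 1
  exact funext h1

lemma xDeriv_evalSlice (P : DiffPoly) (u : SliceSmooth 𝕜) :
    xDeriv 𝕜 (evalSlice P u) = evalSlice (totalD P) u := by
  induction P using MvPolynomial.induction_on with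
  | C q =>
    rw [show (MvPolynomial.C q : DiffPoly) = algebraMap ℚ _ q from rfl, Derivation.map_algebraMap]
    simp only [evalSlice, AlgHom.commutes, map_zero]
    exact (xDeriv 𝕜).restrictScalars ℚ |>.map_algebraMap q
  | add p q hp hq => simp only [evalSlice, map_add] at hp hq ⊢; rw [hp, hq]
  | mul_X p i hp =>
    have hX : xDeriv 𝕜 (evalSlice (MvPolynomial.X i) u) = evalSlice (MvPolynomial.X (i + 1)) u := by
      simp only [evalSlice, MvPolynomial.aeval_X, Function.iterate_succ_apply']
    simp only [evalSlice, map_mul, Derivation.leibniz, totalD_X, smul_eq_mul, map_add] at hp hX ⊢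
    rw [hp, hX]

/-- `½ b_k[u]`. -/
def halfB (u : SliceSmooth 𝕜) (k : ℕ) : SliceSmooth 𝕜 := (1 / 2 : 𝕜) • evalSlice (bCoeff k) u

lemma two_mul_halfB (u : SliceSmooth 𝕜) (k : ℕ) : 2 * halfB u k = evalSlice (bCoeff k) u := by
  rw [halfB, show (2 : SliceSmooth 𝕜) = algebraMap 𝕜 _ 2 from (map_ofNat _ 2).symm,
    ← Algebra.smul_def, smul_smul]
  norm_num

lemma halfB_zero (u : SliceSmooth 𝕜) : halfB u 0 = 0 := by simp [halfB, evalSlice, bCoeff]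

lemma isUnit_two : IsUnit (2 : SliceSmooth 𝕜) := by
  rw [show (2 : SliceSmooth 𝕜) = algebraMap 𝕜 _ 2 from (map_ofNat _ 2).symm]
  exact (IsUnit.mk0 (2 : 𝕜) two_ne_zero).map _

lemma halfB_recursion (u : SliceSmooth 𝕜) (k : ℕ) :
    4 * xDeriv 𝕜 (halfB u (k + 1)) = -(xDeriv 𝕜 (xDeriv 𝕜 (xDeriv 𝕜 (halfB u k)))
      + 4 * u * xDeriv 𝕜 (halfB u k) + 2 * xDeriv 𝕜 u * halfB u k) := by
  have h := congrArg (fun P => evalSlice P u) (totalD_bCoeff_succ k)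
  have h2 : xDeriv 𝕜 (2 : SliceSmooth 𝕜) = 0 := (xDeriv 𝕜).map_natCast 2
  have hq : ∀ (q : ℚ) (P : DiffPoly), evalSlice (q • P) u = q • evalSlice P u :=
    fun q P => map_smul _ q P
  have hX0 : evalSlice (MvPolynomial.X 0) u = u := by simp [evalSlice]
  have hX1 : evalSlice (MvPolynomial.X 1) u = xDeriv 𝕜 u := by simp [evalSlice]
  have e : evalSlice (skewR (bCoeff k)) u
      = -(1 / 4 : ℚ) • evalSlice (totalD (totalD (totalD (bCoeff k)))) u
        - evalSlice (MvPolynomial.X 0) u * evalSlice (totalD (bCoeff k)) u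
        - (1 / 2 : ℚ) • (evalSlice (MvPolynomial.X 1) u * evalSlice (bCoeff k) u) := by
    simp only [skewR, evalSlice, map_sub, map_mul, map_smul]
  simp only [e, ← xDeriv_evalSlice, hX0, hX1, ← two_mul_halfB, Derivation.leibniz, h2, smul_eq_mul,
    mul_zero, add_zero] at h
  simp only [Algebra.smul_def, map_neg] at h
  have h3 : algebraMap ℚ (SliceSmooth 𝕜) (1 / 2) * 2 = 1 := by
    rw [show (2 : SliceSmooth 𝕜) = algebraMap ℚ _ 2 from (map_ofNat _ 2).symm, ← map_mul]; norm_num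
  have h4 : algebraMap ℚ (SliceSmooth 𝕜) (1 / 4) * 4 = 1 := by
    rw [show (4 : SliceSmooth 𝕜) = algebraMap ℚ _ 4 from (map_ofNat _ 4).symm, ← map_mul]; norm_num
  apply isUnit_two.mul_left_cancel
  linear_combination 4 * h - 2 * xDeriv 𝕜 (xDeriv 𝕜 (xDeriv 𝕜 (halfB u k))) * h4
    - 4 * (xDeriv 𝕜 u * halfB u k) * h3

end SliceSmooth

/-! ### Bounded functions and decaying functions -/

open Asymptotics

section Growth

variable {𝕜 : Type*} [RCLike 𝕜] (F : Filter (ℝ × ℝ))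

/-- The `x`-derivatives of `g` up to order `k` are bounded along the filter `F`. -/
def BddOrder : ℕ → SliceSmooth 𝕜 → Prop
  | 0, g => (fun z : ℝ × ℝ => g.1 z.1 z.2) =O[F] (fun _ => (1 : ℝ))
  | k + 1, g => (fun z : ℝ × ℝ => g.1 z.1 z.2) =O[F] (fun _ => (1 : ℝ)) ∧
      BddOrder k (xDeriv 𝕜 g)

/-- The `x`-derivatives of `g` up to order `k` tend to `0` along the filter `F`. -/
def NullOrder : ℕ → SliceSmooth 𝕜 → Prop
  | 0, g => Tendsto (fun z : ℝ × ℝ => g.1 z.1 z.2) F (𝓝 0)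
  | k + 1, g => Tendsto (fun z : ℝ × ℝ => g.1 z.1 z.2) F (𝓝 0) ∧ NullOrder k (xDeriv 𝕜 g)

variable {F}

lemma BddOrder.isBigO {k : ℕ} {g : SliceSmooth 𝕜} (h : BddOrder F k g) :
    (fun z : ℝ × ℝ => g.1 z.1 z.2) =O[F] (fun _ => (1 : ℝ)) := by
  cases k with
  | zero => exact h
  | succ k => exact h.1

lemma NullOrder.tendsto {k : ℕ} {g : SliceSmooth 𝕜} (h : NullOrder F k g) :
    Tendsto (fun z : ℝ × ℝ => g.1 z.1 z.2) F (𝓝 0) := by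
  cases k with
  | zero => exact h
  | succ k => exact h.1

lemma BddOrder.of_succ {k : ℕ} {g : SliceSmooth 𝕜} (h : BddOrder F (k + 1) g) :
    BddOrder F k g := by
  induction k generalizing g with
  | zero => exact h.1
  | succ k ih => exact ⟨h.1, ih h.2⟩

lemma NullOrder.of_succ {k : ℕ} {g : SliceSmooth 𝕜} (h : NullOrder F (k + 1) g) :
    NullOrder F k g := by
  induction k generalizing g with
  | zero => exact h.1
  | succ k ih => exact ⟨h.1, ih h.2⟩

lemma BddOrder.add {k : ℕ} {g h : SliceSmooth 𝕜} (hg : BddOrder F k g) (hh : BddOrder F k h) :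
    BddOrder F k (g + h) := by
  induction k generalizing g h with
  | zero => exact IsBigO.add hg hh
  | succ k ih => exact ⟨hg.1.add hh.1, by rw [map_add]; exact ih hg.2 hh.2⟩

lemma NullOrder.add {k : ℕ} {g h : SliceSmooth 𝕜} (hg : NullOrder F k g) (hh : NullOrder F k h) :
    NullOrder F k (g + h) := by
  induction k generalizing g h with
  | zero =>
    have := Tendsto.add hg hh
    rw [add_zero] at this
    exact this
  | succ k ih => exact ⟨by simpa using hg.1.add hh.1, by rw [map_add]; exact ih hg.2 hh.2⟩

lemma BddOrder.mul {k : ℕ} {g h : SliceSmooth 𝕜} (hg : BddOrder F k g) (hh : BddOrder F k h) :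
    BddOrder F k (g * h) := by
  induction k generalizing g h with
  | zero =>
    have := IsBigO.mul hg hh
    simp only [mul_one] at this
    exact this
  | succ k ih =>
    refine ⟨by simpa using hg.1.mul hh.1, ?_⟩
    rw [Derivation.leibniz]
    exact (ih hg.of_succ hh.2).add (ih hh.of_succ hg.2)

lemma tendsto_zero_mul_of_isBigO {X : Type*} {F : Filter X} {g h : X → 𝕜}
    (hg : g =O[F] (fun _ => (1 : ℝ)))
    (hh : Tendsto h F (𝓝 0)) : Tendsto (fun z => g z * h z) F (𝓝 0) := by
  have := hg.mul_isLittleO ((isLittleO_one_iff ℝ).2 hh)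
  simpa [isLittleO_one_iff] using this

lemma BddOrder.mul_null {k : ℕ} {g h : SliceSmooth 𝕜} (hg : BddOrder F k g)
    (hh : NullOrder F k h) : NullOrder F k (g * h) := by
  induction k generalizing g h with
  | zero => exact tendsto_zero_mul_of_isBigO hg hh
  | succ k ih =>
    refine ⟨tendsto_zero_mul_of_isBigO hg.1 hh.1, ?_⟩
    rw [Derivation.leibniz]
    refine (ih hg.of_succ hh.2).add ?_
    rw [smul_eq_mul, mul_comm]
    exact ih hg.2 hh.of_succ

lemma NullOrder.bdd {k : ℕ} {g : SliceSmooth 𝕜} (h : NullOrder F k g) : BddOrder F k g := by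
  induction k generalizing g with
  | zero => exact Tendsto.isBigO_one ℝ h
  | succ k ih => exact ⟨h.1.isBigO_one ℝ, ih h.2⟩

lemma bddOrder_algebraMap (c : 𝕜) (k : ℕ) :
    BddOrder F k (algebraMap 𝕜 (SliceSmooth 𝕜) c) := by
  have h0 : (fun z : ℝ × ℝ => (algebraMap 𝕜 (SliceSmooth 𝕜) c).1 z.1 z.2)
      =O[F] (fun _ => (1 : ℝ)) := isBigO_const_const c one_ne_zero F
  have hz : ∀ k, BddOrder F k (0 : SliceSmooth 𝕜) := fun k => by
    induction k with
    | zero => exact isBigO_zero _ _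
    | succ k ih => exact ⟨isBigO_zero _ _, by rwa [map_zero]⟩
  cases k with
  | zero => exact h0
  | succ k => exact ⟨h0, by rw [Derivation.map_algebraMap]; exact hz k⟩

variable (𝕜 F) in
/-- The functions all of whose `x`-derivatives are bounded along `F`. -/
def bddAlgebra : Subalgebra 𝕜 (SliceSmooth 𝕜) where
  carrier := {g | ∀ k, BddOrder F k g}
  mul_mem' ha hb k := (ha k).mul (hb k)
  add_mem' ha hb k := (ha k).add (hb k)
  algebraMap_mem' c k := bddOrder_algebraMap c k

variable (𝕜 F) in
/-- The functions all of whose `x`-derivatives tend to `0` along `F`, as a module over the functions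
with bounded derivatives. -/
def nullModule : Submodule (bddAlgebra 𝕜 F) (SliceSmooth 𝕜) where
  carrier := {g | ∀ k, NullOrder F k g}
  add_mem' ha hb k := (ha k).add (hb k)
  zero_mem' k := by
    induction k with
    | zero => exact tendsto_const_nhds
    | succ k ih => exact ⟨tendsto_const_nhds, by rwa [map_zero]⟩
  smul_mem' c _ hg k := (c.2 k).mul_null (hg k)

lemma xDeriv_mem_bddAlgebra {g : SliceSmooth 𝕜} (h : g ∈ bddAlgebra 𝕜 F) :
    xDeriv 𝕜 g ∈ bddAlgebra 𝕜 F := fun k => (h (k + 1)).2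

lemma xDeriv_mem_nullModule {g : SliceSmooth 𝕜} (h : g ∈ nullModule 𝕜 F) :
    xDeriv 𝕜 g ∈ nullModule 𝕜 F := fun k => (h (k + 1)).2

lemma iterate_xDeriv_mem_bddAlgebra {g : SliceSmooth 𝕜} (h : g ∈ bddAlgebra 𝕜 F) (k : ℕ) :
    (xDeriv 𝕜)^[k] g ∈ bddAlgebra 𝕜 F := by
  induction k generalizing g with
  | zero => exact h
  | succ k ih => exact ih (xDeriv_mem_bddAlgebra h)

lemma iterate_xDeriv_mem_nullModule {g : SliceSmooth 𝕜} (h : g ∈ nullModule 𝕜 F) (k : ℕ) :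
    (xDeriv 𝕜)^[k] g ∈ nullModule 𝕜 F := by
  induction k generalizing g with
  | zero => exact h
  | succ k ih => exact ih (xDeriv_mem_nullModule h)

lemma mul_mem_nullModule {g h : SliceSmooth 𝕜} (hg : g ∈ bddAlgebra 𝕜 F)
    (hh : h ∈ nullModule 𝕜 F) : g * h ∈ nullModule 𝕜 F :=
  (nullModule 𝕜 F).smul_mem ⟨g, hg⟩ hh

lemma nullModule_le_bddAlgebra {g : SliceSmooth 𝕜} (hg : g ∈ nullModule 𝕜 F) :
    g ∈ bddAlgebra 𝕜 F := fun k => (hg k).bdd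

lemma mem_bddAlgebra_of_iterate {g : SliceSmooth 𝕜}
    (h : ∀ k, (fun z : ℝ × ℝ => ((xDeriv 𝕜)^[k] g).1 z.1 z.2) =O[F] (fun _ => (1 : ℝ))) :
    g ∈ bddAlgebra 𝕜 F := by
  intro k
  induction k generalizing g with
  | zero => exact h 0
  | succ k ih => exact ⟨h 0, ih fun j => h (j + 1)⟩

/-- If the quadratic expressions in a solution `f` of the Schrödinger equation and its derivative
tend to `0`, then so do all their `x`-derivatives. -/
lemma sq_mem_nullModule {u f l : SliceSmooth 𝕜} (hu : u ∈ bddAlgebra 𝕜 F)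
    (hl : l ∈ bddAlgebra 𝕜 F) (hf : xDeriv 𝕜 (xDeriv 𝕜 f) = -(l + u) * f)
    (h0 : Tendsto (fun z : ℝ × ℝ => (f * f).1 z.1 z.2) F (𝓝 0))
    (h1 : Tendsto (fun z : ℝ × ℝ => (f * xDeriv 𝕜 f).1 z.1 z.2) F (𝓝 0))
    (h2 : Tendsto (fun z : ℝ × ℝ => (xDeriv 𝕜 f * xDeriv 𝕜 f).1 z.1 z.2) F (𝓝 0)) :
    f * f ∈ nullModule 𝕜 F := by
  have h : ∀ k, NullOrder F k (f * f) ∧ NullOrder F k (f * xDeriv 𝕜 f) ∧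
      NullOrder F k (xDeriv 𝕜 f * xDeriv 𝕜 f) := by
    intro k
    induction k with
    | zero => exact ⟨h0, h1, h2⟩
    | succ k ih =>
      obtain ⟨i0, i1, i2⟩ := ih
      have hlu : BddOrder F k (-(l + u)) := neg_mem (add_mem hl hu) k
      refine ⟨⟨h0, ?_⟩, ⟨h1, ?_⟩, ⟨h2, ?_⟩⟩
      · rw [Derivation.leibniz]
        exact i1.add i1
      · rw [Derivation.leibniz, hf]
        convert (hlu.mul_null i0).add i2 using 1
        simp only [smul_eq_mul]
        ring
      · rw [Derivation.leibniz, hf]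
        convert (hlu.mul_null i1).add (hlu.mul_null i1) using 1
        simp only [smul_eq_mul]
        ring
  exact fun k => (h k).1

lemma inv_mem_bddAlgebra {w I : SliceSmooth 𝕜} (hw : w ∈ bddAlgebra 𝕜 F)
    (hI : xDeriv 𝕜 I = -(w * I ^ 2))
    (h0 : (fun z : ℝ × ℝ => I.1 z.1 z.2) =O[F] (fun _ => (1 : ℝ))) : I ∈ bddAlgebra 𝕜 F := by
  intro k
  induction k with
  | zero => exact h0
  | succ k ih =>
    refine ⟨h0, ?_⟩
    rw [hI, pow_two, show -(w * (I * I)) =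
      algebraMap 𝕜 (SliceSmooth 𝕜) (-1) * (w * (I * I)) by rw [map_neg, map_one]; ring]
    exact (bddOrder_algebraMap _ k).mul ((hw k).mul (ih.mul ih))

lemma evalSlice_mem_bddAlgebra {u : SliceSmooth 𝕜} (hu : u ∈ bddAlgebra 𝕜 F) (P : DiffPoly) :
    evalSlice P u ∈ bddAlgebra 𝕜 F := by
  induction P using MvPolynomial.induction_on with
  | C q => exact evalSlice_C q u ▸ (bddAlgebra 𝕜 F).algebraMap_mem _
  | add p q hp hq => simpa only [evalSlice, map_add] using add_mem hp hq
  | mul_X p i hp =>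
    simpa only [evalSlice, map_mul, MvPolynomial.aeval_X] using
      mul_mem hp (iterate_xDeriv_mem_bddAlgebra hu i)

lemma evalSlice_sub_mem_nullModule {u v : SliceSmooth 𝕜} (hu : u ∈ bddAlgebra 𝕜 F)
    (hv : v - u ∈ nullModule 𝕜 F) (P : DiffPoly) :
    evalSlice P v - evalSlice P u ∈ nullModule 𝕜 F := by
  have hvb : v ∈ bddAlgebra 𝕜 F := by
    simpa using add_mem (nullModule_le_bddAlgebra hv) hu
  induction P using MvPolynomial.induction_on with
  | C q => simp [evalSlice]
  | add p q hp hq =>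
    simp only [evalSlice, map_add] at hp hq ⊢
    rw [add_sub_add_comm]
    exact add_mem hp hq
  | mul_X p i hp =>
    have h1 := mul_mem_nullModule (iterate_xDeriv_mem_bddAlgebra hvb i) hp
    have h2 := mul_mem_nullModule (evalSlice_mem_bddAlgebra hu p)
      (iterate_xDeriv_mem_nullModule hv i)
    rw [iterate_xDeriv_sub] at h2
    convert add_mem h1 h2 using 1
    simp only [evalSlice, map_mul, MvPolynomial.aeval_X]
    ring

lemma halfB_mem_bddAlgebra {u : SliceSmooth 𝕜} (hu : u ∈ bddAlgebra 𝕜 F) (k : ℕ) :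
    halfB u k ∈ bddAlgebra 𝕜 F :=
  (bddAlgebra 𝕜 F).smul_mem (evalSlice_mem_bddAlgebra hu _) _

/-- `A f` is a combination of `f` and `f_x` whose coefficients have bounded derivatives. -/
lemma exists_laxSeq_eq {u f l : SliceSmooth 𝕜} (hu : u ∈ bddAlgebra 𝕜 F)
    (hl : l ∈ bddAlgebra 𝕜 F) (m : ℕ) :
    ∃ p ∈ bddAlgebra 𝕜 F, ∃ q ∈ bddAlgebra 𝕜 F,
      laxSeq (xDeriv 𝕜) (halfB u) l f m = p * xDeriv 𝕜 f + q * f := by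
  induction m with
  | zero => exact ⟨0, zero_mem _, 0, zero_mem _, by simp [laxSeq]⟩
  | succ m ih =>
    obtain ⟨p, hp, q, hq, h⟩ := ih
    have hc := halfB_mem_bddAlgebra hu (m + 1)
    refine ⟨l * p + 2 * halfB u (m + 1), add_mem (mul_mem hl hp) (mul_mem (ofNat_mem _ 2) hc),
      l * q - xDeriv 𝕜 (halfB u (m + 1)), sub_mem (mul_mem hl hq) (xDeriv_mem_bddAlgebra hc), ?_⟩
    rw [laxSeq, h]
    ring

/-- The product of two functions and the products with one or both of them differentiated tend to
`0` along `F`. -/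
structure NullProducts (F : Filter (ℝ × ℝ)) (p q : SliceSmooth 𝕜) : Prop where
  mul : Tendsto (fun z : ℝ × ℝ => (p * q).1 z.1 z.2) F (𝓝 0)
  deriv_mul : Tendsto (fun z : ℝ × ℝ => (xDeriv 𝕜 p * q).1 z.1 z.2) F (𝓝 0)
  mul_deriv : Tendsto (fun z : ℝ × ℝ => (p * xDeriv 𝕜 q).1 z.1 z.2) F (𝓝 0)
  deriv_mul_deriv : Tendsto (fun z : ℝ × ℝ => (xDeriv 𝕜 p * xDeriv 𝕜 q).1 z.1 z.2) F (𝓝 0)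

lemma tendsto_lin {p q a b : SliceSmooth 𝕜} (hp : p ∈ bddAlgebra 𝕜 F) (hq : q ∈ bddAlgebra 𝕜 F)
    (ha : Tendsto (fun z : ℝ × ℝ => a.1 z.1 z.2) F (𝓝 0))
    (hb : Tendsto (fun z : ℝ × ℝ => b.1 z.1 z.2) F (𝓝 0)) :
    Tendsto (fun z : ℝ × ℝ => (p * a + q * b).1 z.1 z.2) F (𝓝 0) := by
  have h1 := tendsto_zero_mul_of_isBigO (hp 0).isBigO ha
  have h2 := tendsto_zero_mul_of_isBigO (hq 0).isBigO hb
  simpa using h1.add h2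

lemma tendsto_laxSeq_mul {u f l g : SliceSmooth 𝕜} (hu : u ∈ bddAlgebra 𝕜 F)
    (hl : l ∈ bddAlgebra 𝕜 F)
    (h0 : Tendsto (fun z : ℝ × ℝ => (f * g).1 z.1 z.2) F (𝓝 0))
    (h1 : Tendsto (fun z : ℝ × ℝ => (xDeriv 𝕜 f * g).1 z.1 z.2) F (𝓝 0)) (m : ℕ) :
    Tendsto (fun z : ℝ × ℝ => (laxSeq (xDeriv 𝕜) (halfB u) l f m * g).1 z.1 z.2) F (𝓝 0) := by
  obtain ⟨p, hp, q, hq, h⟩ := exists_laxSeq_eq (f := f) hu hl m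
  convert tendsto_lin hp hq h1 h0 using 4
  rw [h]
  ring

lemma tendsto_deriv_laxSeq_mul {u f l g : SliceSmooth 𝕜} (hu : u ∈ bddAlgebra 𝕜 F)
    (hl : l ∈ bddAlgebra 𝕜 F) (hf : xDeriv 𝕜 (xDeriv 𝕜 f) = -(l + u) * f)
    (h0 : Tendsto (fun z : ℝ × ℝ => (f * g).1 z.1 z.2) F (𝓝 0))
    (h1 : Tendsto (fun z : ℝ × ℝ => (xDeriv 𝕜 f * g).1 z.1 z.2) F (𝓝 0)) (m : ℕ) :
    Tendsto (fun z : ℝ × ℝ => (xDeriv 𝕜 (laxSeq (xDeriv 𝕜) (halfB u) l f m) * g).1 z.1 z.2)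
      F (𝓝 0) := by
  obtain ⟨p, hp, q, hq, h⟩ := exists_laxSeq_eq (f := f) hu hl m
  convert tendsto_lin (add_mem (xDeriv_mem_bddAlgebra hp) hq)
    (sub_mem (xDeriv_mem_bddAlgebra hq) (mul_mem hp (add_mem hl hu))) h1 h0 using 4
  rw [h]
  simp only [map_add, Derivation.leibniz, hf, smul_eq_mul]
  ring

lemma tendsto_fluxSeq {u k f l ψ : SliceSmooth 𝕜} (hu : u ∈ bddAlgebra 𝕜 F)
    (hk : k ∈ bddAlgebra 𝕜 F) (hf : xDeriv 𝕜 (xDeriv 𝕜 f) = -(k + u) * f)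
    (hl : l ∈ bddAlgebra 𝕜 F) (h : NullProducts F f ψ) (m : ℕ) :
    Tendsto (fun z : ℝ × ℝ => (fluxSeq (xDeriv 𝕜) (halfB u) k f l ψ m).1 z.1 z.2) F (𝓝 0) := by
  induction m with
  | zero => exact tendsto_const_nhds
  | succ m ih =>
    have h1 := tendsto_laxSeq_mul hu hk h.mul_deriv h.deriv_mul_deriv m
    have h2 := tendsto_deriv_laxSeq_mul hu hk hf h.mul h.deriv_mul m
    have hc : 2 * halfB u (m + 1) ∈ bddAlgebra 𝕜 F :=
      mul_mem (ofNat_mem _ 2) (halfB_mem_bddAlgebra hu (m + 1))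
    have h3 := (tendsto_lin hl hc ih h.mul).add
      (tendsto_lin (one_mem _) (neg_mem (one_mem _)) h1 h2)
    rw [add_zero] at h3
    have e : fluxSeq (xDeriv 𝕜) (halfB u) k f l ψ (m + 1) =
        (l * fluxSeq (xDeriv 𝕜) (halfB u) k f l ψ m + 2 * halfB u (m + 1) * (f * ψ))
        + (1 * (laxSeq (xDeriv 𝕜) (halfB u) k f m * xDeriv 𝕜 ψ)
          + -1 * (xDeriv 𝕜 (laxSeq (xDeriv 𝕜) (halfB u) k f m) * ψ)) := by
      rw [fluxSeq]
      ring
    rw [e]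
    exact h3

end Growth

/-! ### The hierarchy for the transformed potential -/

section TransformedHierarchy

variable {𝕜 : Type*} [RCLike 𝕜] {F : Filter (ℝ × ℝ)}

lemma BddOrder.mono {F' : Filter (ℝ × ℝ)} (hF : F' ≤ F) {k : ℕ} {g : SliceSmooth 𝕜}
    (h : BddOrder F k g) : BddOrder F' k g := by
  induction k generalizing g with
  | zero => exact IsBigO.mono h hF
  | succ k ih => exact ⟨h.1.mono hF, ih h.2⟩

lemma bddAlgebra_mono {F' : Filter (ℝ × ℝ)} (hF : F' ≤ F) {g : SliceSmooth 𝕜}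
    (h : g ∈ bddAlgebra 𝕜 F) : g ∈ bddAlgebra 𝕜 F' := fun k => (h k).mono hF

lemma NullProducts.mono {F' : Filter (ℝ × ℝ)} (hF : F' ≤ F) {p q : SliceSmooth 𝕜}
    (h : NullProducts F p q) : NullProducts F' p q :=
  ⟨h.mul.mono_left hF, h.deriv_mul.mono_left hF, h.mul_deriv.mono_left hF,
    h.deriv_mul_deriv.mono_left hF⟩

/-- The change `2 ∂(f² / τ)` of the potential tends to `0` with all its derivatives. -/
lemma potential_sub_mem_nullModule {u f k I v : SliceSmooth 𝕜}
    (hf : xDeriv 𝕜 (xDeriv 𝕜 f) = -(k + u) * f) (hI : xDeriv 𝕜 I = -(f ^ 2 * I ^ 2))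
    (hv : v = u + 2 * xDeriv 𝕜 (f ^ 2 * I)) (hu : u ∈ bddAlgebra 𝕜 F)
    (hk : k ∈ bddAlgebra 𝕜 F) (hff : NullProducts F f f)
    (hIb : (fun z : ℝ × ℝ => I.1 z.1 z.2) =O[F] (fun _ => (1 : ℝ))) :
    I ∈ bddAlgebra 𝕜 F ∧ v - u ∈ nullModule 𝕜 F := by
  have hsq := sq_mem_nullModule hu hk hf hff.mul hff.mul_deriv hff.deriv_mul_deriv
  have hIm := inv_mem_bddAlgebra (nullModule_le_bddAlgebra hsq) (by rw [hI, pow_two f]) hIb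
  refine ⟨hIm, ?_⟩
  rw [hv, add_sub_cancel_left]
  refine mul_mem_nullModule (ofNat_mem _ 2) (xDeriv_mem_nullModule ?_)
  rw [mul_comm, pow_two]
  exact mul_mem_nullModule hIm hsq

/-- The coefficients of the hierarchy for the transformed potential. Both sides obey the same
recursion relation, which determines `b_{m+1}` from `b_m` up to a function of `t`, and their
difference tends to `0` at `-∞`. -/
lemma halfB_transformed {u f k I v : SliceSmooth 𝕜} (hk : xDeriv 𝕜 k = 0)
    (hf : xDeriv 𝕜 (xDeriv 𝕜 f) = -(k + u) * f) (hI : xDeriv 𝕜 I = -(f ^ 2 * I ^ 2))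
    (hv : v = u + 2 * xDeriv 𝕜 (f ^ 2 * I))
    (hub : ∀ t, u ∈ bddAlgebra 𝕜 (atBot ×ˢ pure t))
    (hkb : ∀ t, k ∈ bddAlgebra 𝕜 (atBot ×ˢ pure t))
    (hff : ∀ t, NullProducts (atBot ×ˢ pure t) f f)
    (hIb : ∀ t, (fun z : ℝ × ℝ => I.1 z.1 z.2) =O[atBot ×ˢ pure t] (fun _ => (1 : ℝ))) (m : ℕ) :
    2 * halfB v (m + 1) = 2 * halfB u (m + 1)
      - xDeriv 𝕜 (fluxSeq (xDeriv 𝕜) (halfB u) k f k f m * I) := by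
  have h2 : xDeriv 𝕜 (2 : SliceSmooth 𝕜) = 0 := (xDeriv 𝕜).map_natCast 2
  induction m with
  | zero => simp [fluxSeq, halfB, evalSlice, bCoeff]
  | succ m ih =>
    obtain ⟨e, he⟩ : ∃ e : ℕ → SliceSmooth 𝕜, ∀ m, e m = 2 * halfB u (m + 1)
      - xDeriv 𝕜 (fluxSeq (xDeriv 𝕜) (halfB u) k f k f m * I) := ⟨_, fun _ => rfl⟩
    have hrec := transformed_recursion (halfB_zero u) (halfB_recursion u) hk hf hI
      he hv m
    have hrec' := halfB_recursion v (m + 1)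
    rw [← he] at ih ⊢
    obtain ⟨g, hg⟩ : ∃ g, g = 2 * halfB v (m + 1 + 1) - e (m + 1) := ⟨_, rfl⟩
    have hD : xDeriv 𝕜 g = 0 := by
      apply isUnit_two.mul_left_cancel
      apply isUnit_two.mul_left_cancel
      rw [hg, map_sub]
      rw [← ih] at hrec
      simp only [Derivation.leibniz, h2, smul_eq_mul, mul_zero, add_zero] at hrec ⊢
      linear_combination 2 * hrec' - hrec
    have hlim : ∀ t, Tendsto (fun z : ℝ × ℝ => g.1 z.1 z.2) (atBot ×ˢ pure t) (𝓝 0) := by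
      intro t
      obtain ⟨hIm, hvu⟩ := potential_sub_mem_nullModule hf hI hv (hub t) (hkb t) (hff t) (hIb t)
      have h1 := evalSlice_sub_mem_nullModule (hub t) hvu (bCoeff (m + 1 + 1))
      have hQ := tendsto_fluxSeq (hub t) (hkb t) hf (hkb t) (hff t) (m + 1)
      have hA := tendsto_laxSeq_mul (hub t) (hkb t) (hff t).mul (hff t).deriv_mul (m + 1)
      have hsq := sq_mem_nullModule (hub t) (hkb t) hf (hff t).mul (hff t).mul_deriv
        (hff t).deriv_mul_deriv
      have hDI : xDeriv 𝕜 I ∈ bddAlgebra 𝕜 (atBot ×ˢ pure t) := xDeriv_mem_bddAlgebra hIm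
      have h2I : 2 * I ∈ bddAlgebra 𝕜 (atBot ×ˢ pure t) := mul_mem (ofNat_mem _ 2) hIm
      have h3 := tendsto_lin hDI h2I hQ hA
      have h4 := (h1 0).tendsto.add h3
      rw [add_zero] at h4
      have eg : g = (evalSlice (bCoeff (m + 1 + 1)) v - evalSlice (bCoeff (m + 1 + 1)) u)
          + (xDeriv 𝕜 I * fluxSeq (xDeriv 𝕜) (halfB u) k f k f (m + 1)
            + 2 * I * (laxSeq (xDeriv 𝕜) (halfB u) k f (m + 1) * f)) := by
        rw [hg, he, ← two_mul_halfB, ← two_mul_halfB]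
        simp only [Derivation.leibniz, smul_eq_mul,
          fluxSeq_deriv (halfB_zero u) (halfB_recursion u) hk hf hk hf]
        ring
      rw [eg]
      exact h4
    have hg0 : g = 0 := by
      refine Subtype.ext (funext fun x => funext fun t => ?_)
      refine eq_zero_of_xDeriv_eq_zero (fun y => by rw [hD]; rfl) ?_ x
      exact (hlim t).comp (tendsto_id.prodMk (tendsto_const_pure (a := atBot) (b := t)))
    exact sub_eq_zero.1 (hg.symm.trans hg0)

end TransformedHierarchy

/-! ### Joint smoothness in `(x, t)` -/

section JointSmoothness

variable {𝕜 : Type*} [RCLike 𝕜] {T : Set ℝ} {g h : ℝ → ℝ → 𝕜}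

lemma SmoothOn.add (hg : SmoothOn T g) (hh : SmoothOn T h) :
    SmoothOn T (fun x t => g x t + h x t) := ContDiffOn.add hg hh

lemma SmoothOn.sub (hg : SmoothOn T g) (hh : SmoothOn T h) :
    SmoothOn T (fun x t => g x t - h x t) := ContDiffOn.sub hg hh

lemma SmoothOn.mul (hg : SmoothOn T g) (hh : SmoothOn T h) :
    SmoothOn T (fun x t => g x t * h x t) := ContDiffOn.mul hg hh

lemma SmoothOn.inv (hg : SmoothOn T g) (h0 : ∀ x, ∀ t ∈ T, g x t ≠ 0) :
    SmoothOn T (fun x t => (g x t)⁻¹) := ContDiffOn.inv hg fun z hz => h0 z.1 z.2 hz.2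

lemma smoothOn_const (c : 𝕜) : SmoothOn T (fun _ _ => c) := contDiffOn_const

lemma SmoothOn.sum {ι : Type*} {s : Finset ι} {g : ι → ℝ → ℝ → 𝕜}
    (hg : ∀ i ∈ s, SmoothOn T (g i)) : SmoothOn T (fun x t => ∑ i ∈ s, g i x t) :=
  ContDiffOn.sum hg

lemma SmoothOn.congr (hg : SmoothOn T g) (e : ∀ x, ∀ t ∈ T, h x t = g x t) : SmoothOn T h :=
  ContDiffOn.congr hg fun z hz => e z.1 z.2 hz.2

lemma isOpen_strip (hT : IsOpen T) : IsOpen ((univ : Set ℝ) ×ˢ T) := isOpen_univ.prod hT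

lemma SmoothOn.contDiffAt (hT : IsOpen T) (hg : SmoothOn T g) {x t : ℝ} (ht : t ∈ T) :
    ContDiffAt ℝ ∞ (fun z : ℝ × ℝ => g z.1 z.2) (x, t) :=
  ContDiffOn.contDiffAt hg ((isOpen_strip hT).mem_nhds ⟨mem_univ _, ht⟩)

lemma SmoothOn.hasDerivAt_x (hT : IsOpen T) (hg : SmoothOn T g) {x t : ℝ} (ht : t ∈ T) :
    HasDerivAt (fun y => g y t) (fderiv ℝ (fun z : ℝ × ℝ => g z.1 z.2) (x, t) (1, 0)) x := by
  have h1 := ((hg.contDiffAt hT (x := x) ht).differentiableAt (by simp)).hasFDerivAt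
  exact h1.comp_hasDerivAt (f := fun y : ℝ => (y, t)) x
    ((hasDerivAt_id x).prodMk (hasDerivAt_const x t))

lemma SmoothOn.hasDerivAt_t (hT : IsOpen T) (hg : SmoothOn T g) {x t : ℝ} (ht : t ∈ T) :
    HasDerivAt (fun s => g x s) (fderiv ℝ (fun z : ℝ × ℝ => g z.1 z.2) (x, t) (0, 1)) t := by
  have h1 := ((hg.contDiffAt hT (x := x) ht).differentiableAt (by simp)).hasFDerivAt
  exact h1.comp_hasDerivAt (f := fun s : ℝ => (x, s)) t
    ((hasDerivAt_const t x).prodMk (hasDerivAt_id t))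

lemma SmoothOn.hasDerivAt_dx (hT : IsOpen T) (hg : SmoothOn T g) {x t : ℝ} (ht : t ∈ T) :
    HasDerivAt (fun y => g y t) (dx g x t) x :=
  (hg.hasDerivAt_x hT ht).differentiableAt.hasDerivAt

lemma SmoothOn.hasDerivAt_dt (hT : IsOpen T) (hg : SmoothOn T g) {x t : ℝ} (ht : t ∈ T) :
    HasDerivAt (fun s => g x s) (dt g x t) t :=
  (hg.hasDerivAt_t hT ht).differentiableAt.hasDerivAt

lemma SmoothOn.fderiv_apply (hT : IsOpen T) (hg : SmoothOn T g) (v : ℝ × ℝ) :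
    SmoothOn T (fun x t => fderiv ℝ (fun z : ℝ × ℝ => g z.1 z.2) (x, t) v) :=
  ((contDiffOn_infty_iff_fderiv_of_isOpen (isOpen_strip hT)).1 hg).2.clm_apply contDiffOn_const

lemma SmoothOn.dx (hT : IsOpen T) (hg : SmoothOn T g) : SmoothOn T (dx g) :=
  (hg.fderiv_apply hT (1, 0)).congr fun _ _ ht => (hg.hasDerivAt_x hT ht).deriv

lemma SmoothOn.dt (hT : IsOpen T) (hg : SmoothOn T g) : SmoothOn T (dt g) :=
  (hg.fderiv_apply hT (0, 1)).congr fun _ _ ht => (hg.hasDerivAt_t hT ht).deriv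

lemma dt_congr (hT : IsOpen T) (e : ∀ x, ∀ t ∈ T, h x t = g x t) {x t : ℝ} (ht : t ∈ T) :
    dt h x t = dt g x t :=
  EventuallyEq.deriv_eq (eventually_of_mem (hT.mem_nhds ht) fun s hs => e x s hs)

lemma dx_congr (e : ∀ x, ∀ t ∈ T, h x t = g x t) {x t : ℝ} (ht : t ∈ T) :
    dx h x t = dx g x t := by
  rw [dx, dx, show (fun y => h y t) = fun y => g y t from funext fun y => e y t ht]

lemma dt_dx_comm (hT : IsOpen T) (hg : SmoothOn T g) {x t : ℝ} (ht : t ∈ T) :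
    dt (dx g) x t = dx (dt g) x t := by
  set G : ℝ × ℝ → 𝕜 := fun z => g z.1 z.2 with hG
  have hC := hg.contDiffAt hT (x := x) ht
  have hsymm : IsSymmSndFDerivAt ℝ G (x, t) := hC.isSymmSndFDerivAt (by
    rw [minSmoothness_of_isRCLikeNormedField]; exact WithTop.coe_le_coe.2 (le_top : (2 : ℕ∞) ≤ ⊤))
  have hdd : DifferentiableAt ℝ (fderiv ℝ G) (x, t) :=
    (hC.fderiv_right (m := ∞) (by simp)).differentiableAt (by simp)
  have e1 : dt (dx g) x t = dt (fun y s => fderiv ℝ G (y, s) (1, 0)) x t :=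
    dt_congr hT (fun _ _ hs => (hg.hasDerivAt_x hT hs).deriv) ht
  have e2 : dx (dt g) x t = dx (fun y s => fderiv ℝ G (y, s) (0, 1)) x t :=
    dx_congr (T := T) (fun _ _ hs => (hg.hasDerivAt_t hT hs).deriv) ht
  have h1 : HasDerivAt (fun s => fderiv ℝ G (x, s)) (fderiv ℝ (fderiv ℝ G) (x, t) (0, 1)) t :=
    hdd.hasFDerivAt.comp_hasDerivAt (f := fun s : ℝ => (x, s)) t
      ((hasDerivAt_const t x).prodMk (hasDerivAt_id t))
  have h2 : HasDerivAt (fun y => fderiv ℝ G (y, t)) (fderiv ℝ (fderiv ℝ G) (x, t) (1, 0)) x :=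
    hdd.hasFDerivAt.comp_hasDerivAt (f := fun y : ℝ => (y, t)) x
      ((hasDerivAt_id x).prodMk (hasDerivAt_const x t))
  rw [e1, e2]
  have h1' := (h1.clm_apply (hasDerivAt_const t ((1 : ℝ), (0 : ℝ)))).deriv
  have h2' := (h2.clm_apply (hasDerivAt_const x ((0 : ℝ), (1 : ℝ)))).deriv
  simp only [map_zero, add_zero] at h1' h2'
  exact h1'.trans ((hsymm _ _).trans h2'.symm)

lemma smoothOn_of_partials (hT : IsOpen T) {a b : ℝ → ℝ → 𝕜} (ha : SmoothOn T a)
    (hb : SmoothOn T b) (h1 : ∀ x, ∀ t ∈ T, HasDerivAt (fun y => g y t) (a x t) x)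
    (h2 : ∀ x, ∀ t ∈ T, HasDerivAt (fun s => g x s) (b x t) t) : SmoothOn T g := by
  let R : 𝕜 →L[ℝ] (ℝ →L[ℝ] 𝕜) := ContinuousLinearMap.smulRightL ℝ ℝ 𝕜 1
  have hR : ∀ c : 𝕜, R c = ContinuousLinearMap.toSpanSingleton ℝ c := fun c => by
    ext; simp [R]
  have hd : ∀ z ∈ (univ : Set ℝ) ×ˢ T, HasFDerivAt (fun z : ℝ × ℝ => g z.1 z.2)
      ((R (a z.1 z.2)).coprod (R (b z.1 z.2))) z := by
    intro z hz
    have hn := (isOpen_strip hT).mem_nhds hz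
    refine (hasStrictFDerivAt_uncurry_coprod (f := g) (f₁ := fun x t => R (a x t))
      (f₂ := fun x t => R (b x t)) ?_ ?_ ?_ ?_).hasFDerivAt
    · filter_upwards [hn] with w hw
      have := (h1 w.1 w.2 hw.2).hasFDerivAt
      rwa [← hR] at this
    · filter_upwards [hn] with w hw
      have := (h2 w.1 w.2 hw.2).hasFDerivAt
      rwa [← hR] at this
    · exact R.continuous.continuousAt.comp (ha.contDiffAt hT (x := z.1) hz.2).continuousAt
    · exact R.continuous.continuousAt.comp (hb.contDiffAt hT (x := z.1) hz.2).continuousAt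
  refine (contDiffOn_infty_iff_fderiv_of_isOpen (isOpen_strip hT)).2
    ⟨fun z hz => (hd z hz).differentiableAt.differentiableWithinAt, ?_⟩
  have hsum : ContDiffOn ℝ ∞ (fun z : ℝ × ℝ =>
      (R (a z.1 z.2)).comp (ContinuousLinearMap.fst ℝ ℝ ℝ)
        + (R (b z.1 z.2)).comp (ContinuousLinearMap.snd ℝ ℝ ℝ)) (univ ×ˢ T) :=
    ((R.contDiff.comp_contDiffOn ha).clm_comp contDiffOn_const).add
      ((R.contDiff.comp_contDiffOn hb).clm_comp contDiffOn_const)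
  refine hsum.congr fun z hz => ?_
  rw [(hd z hz).fderiv]
  ext <;> simp

/-- A function with smooth `x`-derivative whose `t`-derivative satisfies a linear first-order
equation with smooth inhomogeneity is smooth: the integrating factor removes the function itself
from its `t`-derivative. -/
lemma smoothOn_of_linear_partials (hT : IsOpen T) {a b : ℝ → ℝ → 𝕜} (c : 𝕜) (ha : SmoothOn T a)
    (hb : SmoothOn T b) (h1 : ∀ x, ∀ t ∈ T, HasDerivAt (fun y => g y t) (a x t) x)
    (h2 : ∀ x, ∀ t ∈ T, HasDerivAt (fun s => g x s) (c * g x t + b x t) t) : SmoothOn T g := by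
  let E : ℝ → 𝕜 := fun t => NormedSpace.exp (t • (-c))
  have hE : ∀ t, HasDerivAt E (E t * (-c)) t := fun t => hasDerivAt_exp_smul_const (-c) t
  have hE0 : ∀ t, E t ≠ 0 := fun t => (NormedSpace.isUnit_exp (t • (-c))).ne_zero
  have hEs : SmoothOn T (fun _ t => E t) := by
    have hk : ∀ k : ℕ, ContDiff ℝ k E := by
      intro k
      induction k with
      | zero => exact contDiff_zero.2 (continuous_iff_continuousAt.2 fun t => (hE t).continuousAt)
      | succ k ih =>
        rw [show ((k + 1 : ℕ) : ℕ∞ω) = (k : ℕ∞ω) + 1 by push_cast; rfl]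
        refine contDiff_succ_iff_deriv.2 ⟨fun t => (hE t).differentiableAt, by simp, ?_⟩
        rw [show deriv E = fun t => E t * (-c) from funext fun t => (hE t).deriv]
        exact ih.mul contDiff_const
    exact ((contDiff_infty.2 hk).comp contDiff_snd).contDiffOn
  have hs : SmoothOn T (fun x t => E t * g x t) := by
    refine smoothOn_of_partials hT (hEs.mul ha) (hEs.mul hb) (fun x t ht => ?_) fun x t ht => ?_
    · exact (h1 x t ht).const_mul (E t)
    · refine ((hE t).mul (h2 x t ht)).congr_deriv ?_
      ring
  exact ((hEs.inv fun _ t _ => hE0 t).mul hs).congr fun x t _ => by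
    rw [inv_mul_cancel_left₀ (hE0 t)]

end JointSmoothness

/-! ### Integrals from `-∞` -/

open Asymptotics MeasureTheory

section Integrals

variable {𝕜 : Type*} [RCLike 𝕜] {T : Set ℝ} {g p q : ℝ → ℝ → 𝕜}

/-- `g` is dominated on `x ≤ 0`, locally uniformly in `t ∈ T`, by an integrable function of `x`. -/
def Dominated (T : Set ℝ) (g : ℝ → ℝ → 𝕜) : Prop :=
  ∀ t₀ ∈ T, ∃ V ∈ 𝓝 t₀, ∃ G : ℝ → ℝ, IntegrableOn G (Iic 0) ∧ ∀ t ∈ V, ∀ x ≤ 0, ‖g x t‖ ≤ G x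

lemma ProductDecays.dominated (h : ProductDecays T p q) :
    Dominated T (fun x t => p x t * q x t) := fun t₀ ht => by
  obtain ⟨V, hV, G, hG, -, hb⟩ := h t₀ ht
  exact ⟨V, hV, G, hG, fun t ht x hx => (hb t ht x hx).1⟩

lemma ProductDecays.symm (h : ProductDecays T p q) : ProductDecays T q p := fun t₀ ht => by
  obtain ⟨V, hV, G, hG, hl, hb⟩ := h t₀ ht
  refine ⟨V, hV, G, hG, hl, fun t ht x hx => ?_⟩
  obtain ⟨h1, h2, h3, h4⟩ := hb t ht x hx
  exact ⟨by rwa [mul_comm], by rwa [mul_comm], by rwa [mul_comm], by rwa [mul_comm]⟩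

lemma ProductDecays.nullProducts (h : ProductDecays T p q) (hT : IsOpen T)
    {P Q : SliceSmooth 𝕜} (hP : ∀ x, ∀ t ∈ T, P.1 x t = p x t)
    (hQ : ∀ x, ∀ t ∈ T, Q.1 x t = q x t) {t₀ : ℝ} (ht₀ : t₀ ∈ T) :
    NullProducts (atBot ×ˢ 𝓝 t₀) P Q := by
  obtain ⟨V, hV, G, hG, hl, hb⟩ := h t₀ ht₀
  have hev : ∀ᶠ z : ℝ × ℝ in atBot ×ˢ 𝓝 t₀, z.1 ≤ 0 ∧ z.2 ∈ V ∩ T :=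
    (eventually_le_atBot 0).prod_mk (inter_mem hV (hT.mem_nhds ht₀))
  have hl' : Tendsto (fun z : ℝ × ℝ => G z.1) (atBot ×ˢ 𝓝 t₀) (𝓝 0) := hl.comp tendsto_fst
  refine ⟨?_, ?_, ?_, ?_⟩ <;> refine squeeze_zero_norm' (hev.mono fun z hz => ?_) hl' <;>
    have hz' := hb z.2 hz.2.1 z.1 hz.1
  · change ‖P.1 z.1 z.2 * Q.1 z.1 z.2‖ ≤ _
    rw [hP _ _ hz.2.2, hQ _ _ hz.2.2]
    exact hz'.1
  · change ‖(xDeriv 𝕜 P).1 z.1 z.2 * Q.1 z.1 z.2‖ ≤ _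
    rw [xDeriv_eq_dx fun x => hP x _ hz.2.2, hQ _ _ hz.2.2]
    exact hz'.2.1
  · change ‖P.1 z.1 z.2 * (xDeriv 𝕜 Q).1 z.1 z.2‖ ≤ _
    rw [xDeriv_eq_dx fun x => hQ x _ hz.2.2, hP _ _ hz.2.2]
    exact hz'.2.2.1
  · change ‖(xDeriv 𝕜 P).1 z.1 z.2 * (xDeriv 𝕜 Q).1 z.1 z.2‖ ≤ _
    rw [xDeriv_eq_dx fun x => hQ x _ hz.2.2, xDeriv_eq_dx fun x => hP x _ hz.2.2]
    exact hz'.2.2.2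

lemma Dominated.integrableOn (h : Dominated T g) {t : ℝ} (ht : t ∈ T)
    (hc : Continuous fun x => g x t) (x : ℝ) : IntegrableOn (fun y => g y t) (Iic x) := by
  obtain ⟨V, hV, G, hG, hb⟩ := h t ht
  have h0 : IntegrableOn (fun y => g y t) (Iic 0) :=
    Integrable.mono' hG hc.aestronglyMeasurable
      ((ae_restrict_mem measurableSet_Iic).mono fun y hy => hb t (mem_of_mem_nhds hV) y hy)
  have h1 : IntegrableOn (fun y => g y t) (Icc 0 x) := hc.continuousOn.integrableOn_Icc
  refine (h0.union h1).mono_set fun y hy => ?_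
  rcases le_total y 0 with h | h
  · exact Or.inl h
  · exact Or.inr ⟨h, hy⟩

lemma Dominated.hasDerivAt_intX (h : Dominated T g) {t : ℝ} (ht : t ∈ T)
    (hc : Continuous fun x => g x t) (x : ℝ) :
    HasDerivAt (fun y => intX g y t) (g x t) x := by
  have h1 : HasDerivAt (fun y => intX g 0 t + ∫ z in (0 : ℝ)..y, g z t) (g x t) x :=
    (intervalIntegral.integral_hasDerivAt_right (hc.intervalIntegrable _ _)
      hc.stronglyMeasurable.stronglyMeasurableAtFilter hc.continuousAt).const_add _
  refine h1.congr_of_eventuallyEq (Eventually.of_forall fun y => ?_)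
  change intX g y t = intX g 0 t + ∫ z in (0 : ℝ)..y, g z t
  rw [← intervalIntegral.integral_Iic_sub_Iic (h.integrableOn ht hc 0) (h.integrableOn ht hc y)]
  simp [intX]

lemma Dominated.contDiff_intX (h : Dominated T g) {t : ℝ} (ht : t ∈ T)
    (hc : ContDiff ℝ ∞ fun x => g x t) : ContDiff ℝ ∞ (fun x => intX g x t) := by
  have hd := h.hasDerivAt_intX ht hc.continuous
  refine contDiff_infty_iff_deriv.2 ⟨fun x => (hd x).differentiableAt, ?_⟩
  rwa [show deriv (fun x => intX g x t) = fun x => g x t from funext fun x => (hd x).deriv]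

lemma Dominated.tendsto_intX (h : Dominated T g) {t₀ : ℝ} (ht : t₀ ∈ T) :
    Tendsto (fun z : ℝ × ℝ => intX g z.1 z.2) (atBot ×ˢ 𝓝 t₀) (𝓝 0) := by
  obtain ⟨V, hV, G, hG, hb⟩ := h t₀ ht
  have hlim : Tendsto (fun x => ∫ y in Iic x, G y) atBot (𝓝 0) := by
    have h1 := intervalIntegral_tendsto_integral_Iic (0 : ℝ) hG tendsto_id
    have h2 : Tendsto (fun x => (∫ y in Iic (0 : ℝ), G y) - ∫ y in x..0, G y) atBot (𝓝 0) := by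
      simpa using h1.const_sub (∫ y in Iic (0 : ℝ), G y)
    refine h2.congr' ?_
    filter_upwards [eventually_le_atBot 0] with x hx
    rw [← intervalIntegral.integral_Iic_sub_Iic (hG.mono_set (Iic_subset_Iic.2 hx)) hG]
    ring
  have hev : ∀ᶠ z : ℝ × ℝ in atBot ×ˢ 𝓝 t₀, z.1 ≤ 0 ∧ z.2 ∈ V :=
    (eventually_le_atBot 0).prod_mk hV
  refine squeeze_zero_norm' (hev.mono fun z hz => ?_) (hlim.comp tendsto_fst)
  refine norm_integral_le_of_norm_le (hG.mono_set (Iic_subset_Iic.2 hz.1)) ?_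
  exact (ae_restrict_mem measurableSet_Iic).mono fun y hy => hb z.2 hz.2 y (hy.out.trans hz.1)

/-- An antiderivative that tends to `0` at `-∞` is the integral from `-∞`. -/
lemma Dominated.intX_eq (h : Dominated T g) {t : ℝ} (ht : t ∈ T)
    (hc : Continuous fun x => g x t) {s : ℝ → 𝕜} (hs : ∀ x, HasDerivAt s (g x t) x)
    (h0 : Tendsto s atBot (𝓝 0)) (x : ℝ) : intX g x t = s x := by
  have := integral_Iic_of_hasDerivAt_of_tendsto' (fun y _ => hs y) (h.integrableOn ht hc x) h0
  rwa [sub_zero] at this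

/-- Differentiation under the integral sign: if the integrand satisfies the conservation law
`g_t = H_x` with a flux `H` that tends to `0` at `-∞` locally uniformly in `t`, then
`(∂⁻¹ g)_t = H`. -/
lemma Dominated.hasDerivAt_intX_t (hT : IsOpen T) (h : Dominated T g) (hg : SmoothOn T g)
    {H : ℝ → ℝ → 𝕜} (hH : ∀ x, ∀ t ∈ T, HasDerivAt (fun y => H y t) (dt g x t) x) {t₀ : ℝ}
    (ht₀ : t₀ ∈ T)
    (h0 : Tendsto (fun z : ℝ × ℝ => H z.1 z.2) (atBot ×ˢ 𝓝 t₀) (𝓝 0)) (x : ℝ) :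
    HasDerivAt (fun t => intX g x t) (H x t₀) t₀ := by
  have hcont : ∀ t ∈ T, Continuous fun y => g y t := fun t ht => (hg.contDiff_slice ht).continuous
  have hcont' : ∀ t ∈ T, Continuous fun y => dt g y t :=
    fun t ht => ((hg.dt hT).contDiff_slice ht).continuous
  -- the integrals over bounded intervals can be differentiated in `t`
  have hloc : ∀ a, ∀ t ∈ T, HasDerivAt (fun t => ∫ y in a..x, g y t) (H x t - H a t) t := by
    intro a t ht
    obtain ⟨r, hr, hball⟩ := Metric.nhds_basis_closedBall.mem_iff.1 (hT.mem_nhds ht)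
    have hK : IsCompact (uIcc a x ×ˢ Metric.closedBall t r) :=
      isCompact_uIcc.prod (isCompact_closedBall t r)
    obtain ⟨C, hC⟩ := hK.exists_bound_of_continuousOn
      (f := fun z : ℝ × ℝ => dt g z.1 z.2)
      ((ContDiffOn.continuousOn (hg.dt hT)).mono (prod_mono (subset_univ _) hball))
    have key := intervalIntegral.hasDerivAt_integral_of_dominated_loc_of_deriv_le
      (μ := volume) (a := a) (b := x) (F := fun t y => g y t) (F' := fun t y => dt g y t)
      (bound := fun _ => C) (Metric.closedBall_mem_nhds t hr)
      ((eventually_of_mem (hT.mem_nhds ht)) fun s hs => (hcont s hs).aestronglyMeasurable)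
      ((hcont t ht).intervalIntegrable _ _) (hcont' t ht).aestronglyMeasurable
      (Eventually.of_forall fun y hy s hs => hC (y, s) ⟨uIoc_subset_uIcc hy, hs⟩)
      intervalIntegrable_const
      (Eventually.of_forall fun y _ s hs => hg.hasDerivAt_dt hT (hball hs))
    refine key.2.congr_deriv ?_
    exact intervalIntegral.integral_eq_sub_of_hasDerivAt (fun y _ => hH y t ht)
      ((hcont' t ht).intervalIntegrable _ _)
  refine hasDerivAt_of_tendstoUniformlyOnFilter (l := atBot)
    (f := fun a t => ∫ y in a..x, g y t) (f' := fun a t => H x t - H a t)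
    (g' := fun t => H x t) ?_ ?_ ?_
  · rw [Metric.tendstoUniformlyOnFilter_iff]
    intro ε hε
    filter_upwards [Metric.tendsto_nhds.1 h0 ε hε] with z hz
    simpa [dist_eq_norm] using hz
  · filter_upwards [(eventually_of_mem (hT.mem_nhds ht₀) fun t ht => ht :
      ∀ᶠ t in 𝓝 t₀, t ∈ T).prod_inr atBot] with z hz
    exact hloc z.1 z.2 hz
  · filter_upwards [hT.mem_nhds ht₀] with t ht
    exact intervalIntegral_tendsto_integral_Iic x (h.integrableOn ht (hcont t ht) x) tendsto_id

/-- `g` is bounded on `x ≤ 0`, locally uniformly in `t ∈ T`. -/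
def LocBounded (T : Set ℝ) (g : ℝ → ℝ → 𝕜) : Prop :=
  ∀ t₀ ∈ T, ∃ V ∈ 𝓝 t₀, ∃ C : ℝ, ∀ t ∈ V, ∀ x ≤ 0, ‖g x t‖ ≤ C

/-- By compactness, a continuous function is bounded on `x ≤ 0` as soon as it is bounded near
`x = -∞`. -/
lemma locBounded_of_isBigO (hT : IsOpen T) (hg : SmoothOn T g)
    (h : ∀ t ∈ T, (fun z : ℝ × ℝ => g z.1 z.2) =O[atBot ×ˢ 𝓝 t] (fun _ => (1 : ℝ))) :
    LocBounded T g := by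
  intro t ht
  obtain ⟨C₁, hC₁⟩ := (h t ht).bound
  obtain ⟨P, hP, Q, hQ, hPQ⟩ := eventually_prod_iff.1 hC₁
  obtain ⟨X, hX⟩ := eventually_atBot.1 hP
  obtain ⟨r, hr, hball⟩ := Metric.nhds_basis_closedBall.mem_iff.1 (hT.mem_nhds ht)
  have hK : IsCompact (Icc X 0 ×ˢ Metric.closedBall t r) :=
    isCompact_Icc.prod (isCompact_closedBall t r)
  obtain ⟨C₂, hC₂⟩ := hK.exists_bound_of_continuousOn (f := fun z : ℝ × ℝ => g z.1 z.2)
    ((ContDiffOn.continuousOn hg).mono (prod_mono (subset_univ _) hball))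
  refine ⟨{s | Q s} ∩ Metric.closedBall t r, inter_mem hQ (Metric.closedBall_mem_nhds t hr),
    max C₁ C₂, fun s hs x hx => ?_⟩
  rcases le_total x X with hxX | hxX
  · have := hPQ (hX x hxX) hs.1
    simp only [norm_one, mul_one] at this
    exact this.trans (le_max_left _ _)
  · exact (hC₂ (x, s) ⟨⟨hxX, hx⟩, hs.2⟩).trans (le_max_right _ _)

/-- Decay of products is inherited by combinations of `p, p_x, f, f_x` and of `q, q_x, f, f_x` with
bounded coefficients. -/
lemma productDecays_of_le {f P Q : ℝ → ℝ → 𝕜} (hpq : ProductDecays T p q)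
    (hpf : ProductDecays T p f) (hfq : ProductDecays T f q) (hff : ProductDecays T f f)
    (hP : ∀ t₀ ∈ T, ∃ V ∈ 𝓝 t₀, ∃ C : ℝ, ∀ t ∈ V, ∀ x ≤ 0,
      ‖P x t‖ ≤ C * (‖p x t‖ + ‖dx p x t‖ + ‖f x t‖ + ‖dx f x t‖) ∧
      ‖dx P x t‖ ≤ C * (‖p x t‖ + ‖dx p x t‖ + ‖f x t‖ + ‖dx f x t‖))
    (hQ : ∀ t₀ ∈ T, ∃ V ∈ 𝓝 t₀, ∃ C : ℝ, ∀ t ∈ V, ∀ x ≤ 0,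
      ‖Q x t‖ ≤ C * (‖q x t‖ + ‖dx q x t‖ + ‖f x t‖ + ‖dx f x t‖) ∧
      ‖dx Q x t‖ ≤ C * (‖q x t‖ + ‖dx q x t‖ + ‖f x t‖ + ‖dx f x t‖)) :
    ProductDecays T P Q := by
  intro t₀ ht₀
  obtain ⟨V₁, hV₁, G₁, hG₁, hl₁, hb₁⟩ := hpq t₀ ht₀
  obtain ⟨V₂, hV₂, G₂, hG₂, hl₂, hb₂⟩ := hpf t₀ ht₀
  obtain ⟨V₃, hV₃, G₃, hG₃, hl₃, hb₃⟩ := hfq t₀ ht₀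
  obtain ⟨V₄, hV₄, G₄, hG₄, hl₄, hb₄⟩ := hff t₀ ht₀
  obtain ⟨W₁, hW₁, C₁, hC₁⟩ := hP t₀ ht₀
  obtain ⟨W₂, hW₂, C₂, hC₂⟩ := hQ t₀ ht₀
  refine ⟨V₁ ∩ V₂ ∩ V₃ ∩ V₄ ∩ W₁ ∩ W₂, inter_mem (inter_mem (inter_mem (inter_mem
    (inter_mem hV₁ hV₂) hV₃) hV₄) hW₁) hW₂,
    fun x => |C₁| * |C₂| * (4 * (G₁ x + G₂ x + G₃ x + G₄ x)),
    (((hG₁.add hG₂).add hG₃).add hG₄).const_mul _ |>.const_mul _, ?_, ?_⟩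
  · simpa using ((((hl₁.add hl₂).add hl₃).add hl₄).const_mul 4).const_mul (|C₁| * |C₂|)
  rintro t ⟨⟨⟨⟨⟨h1, h2⟩, h3⟩, h4⟩, h5⟩, h6⟩ x hx
  obtain ⟨a1, a2, a3, a4⟩ := hb₁ t h1 x hx
  obtain ⟨b1, b2, b3, b4⟩ := hb₂ t h2 x hx
  obtain ⟨c1, c2, c3, c4⟩ := hb₃ t h3 x hx
  obtain ⟨d1, d2, d3, d4⟩ := hb₄ t h4 x hx
  obtain ⟨e1, e2⟩ := hC₁ t h5 x hx
  obtain ⟨f1, f2⟩ := hC₂ t h6 x hx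
  rw [norm_mul] at a1 a2 a3 a4 b1 b2 b3 b4 c1 c2 c3 c4 d1 d2 d3 d4
  set σ := ‖p x t‖ + ‖dx p x t‖ + ‖f x t‖ + ‖dx f x t‖ with hσ
  set ρ := ‖q x t‖ + ‖dx q x t‖ + ‖f x t‖ + ‖dx f x t‖ with hρ
  have hσ0 : 0 ≤ σ := by positivity
  have hρ0 : 0 ≤ ρ := by positivity
  have hσρ : σ * ρ ≤ 4 * (G₁ x + G₂ x + G₃ x + G₄ x) := by
    rw [hσ, hρ]
    linarith
  have main : ∀ y z : 𝕜, ‖y‖ ≤ C₁ * σ → ‖z‖ ≤ C₂ * ρ →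
      ‖y * z‖ ≤ |C₁| * |C₂| * (4 * (G₁ x + G₂ x + G₃ x + G₄ x)) := by
    intro y z hy hz
    have hy' : ‖y‖ ≤ |C₁| * σ := hy.trans (by gcongr; exact le_abs_self _)
    have hz' : ‖z‖ ≤ |C₂| * ρ := hz.trans (by gcongr; exact le_abs_self _)
    calc ‖y * z‖ ≤ (|C₁| * σ) * (|C₂| * ρ) := by
          rw [norm_mul]; exact mul_le_mul hy' hz' (norm_nonneg _) (by positivity)
      _ = |C₁| * |C₂| * (σ * ρ) := by ring
      _ ≤ _ := by gcongr
  exact ⟨main _ _ e1 f1, main _ _ e2 f1, main _ _ e1 f2, main _ _ e2 f2⟩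

end Integrals

/-! ### Jointly smooth elements and wave functions -/

section JointAlgebra

variable {𝕜 : Type*} [RCLike 𝕜] {T : Set ℝ}

/-- The elements of the differential algebra that are smooth in `(x, t)` on `ℝ × T`. -/
def jointAlgebra (𝕜 : Type*) [RCLike 𝕜] (T : Set ℝ) : Subalgebra 𝕜 (SliceSmooth 𝕜) where
  carrier := {g | SmoothOn T g.1}
  mul_mem' ha hb := SmoothOn.mul ha hb
  add_mem' ha hb := SmoothOn.add ha hb
  algebraMap_mem' c := smoothOn_const c

lemma xDeriv_mem_jointAlgebra (hT : IsOpen T) {g : SliceSmooth 𝕜} (h : g ∈ jointAlgebra 𝕜 T) :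
    xDeriv 𝕜 g ∈ jointAlgebra 𝕜 T := SmoothOn.dx hT h

lemma iterate_xDeriv_mem_jointAlgebra (hT : IsOpen T) {g : SliceSmooth 𝕜}
    (h : g ∈ jointAlgebra 𝕜 T) (k : ℕ) : (xDeriv 𝕜)^[k] g ∈ jointAlgebra 𝕜 T := by
  induction k generalizing g with
  | zero => exact h
  | succ k ih => exact ih (xDeriv_mem_jointAlgebra hT h)

lemma halfB_mem_jointAlgebra (hT : IsOpen T) {u : SliceSmooth 𝕜} (hu : u ∈ jointAlgebra 𝕜 T)
    (k : ℕ) : halfB u k ∈ jointAlgebra 𝕜 T := by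
  refine (jointAlgebra 𝕜 T).smul_mem ?_ _
  induction bCoeff k using MvPolynomial.induction_on with
  | C q => exact evalSlice_C q u ▸ (jointAlgebra 𝕜 T).algebraMap_mem _
  | add p q hp hq => simpa only [evalSlice, map_add] using add_mem hp hq
  | mul_X p i hp =>
    simpa only [evalSlice, map_mul, MvPolynomial.aeval_X] using
      mul_mem hp (iterate_xDeriv_mem_jointAlgebra hT hu i)

lemma laxSeq_mem_jointAlgebra (hT : IsOpen T) {u l ψ : SliceSmooth 𝕜}
    (hu : u ∈ jointAlgebra 𝕜 T) (hl : l ∈ jointAlgebra 𝕜 T) (hψ : ψ ∈ jointAlgebra 𝕜 T) (m : ℕ) :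
    laxSeq (xDeriv 𝕜) (halfB u) l ψ m ∈ jointAlgebra 𝕜 T := by
  induction m with
  | zero => exact zero_mem _
  | succ m ih =>
    have hc := halfB_mem_jointAlgebra hT hu (m + 1)
    exact add_mem (mul_mem hl ih) (sub_mem (mul_mem (mul_mem (ofNat_mem _ 2) hc)
      (xDeriv_mem_jointAlgebra hT hψ)) (mul_mem (xDeriv_mem_jointAlgebra hT hc) hψ))

lemma fluxSeq_mem_jointAlgebra (hT : IsOpen T) {u k f l ψ : SliceSmooth 𝕜}
    (hu : u ∈ jointAlgebra 𝕜 T) (hk : k ∈ jointAlgebra 𝕜 T) (hf : f ∈ jointAlgebra 𝕜 T)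
    (hl : l ∈ jointAlgebra 𝕜 T) (hψ : ψ ∈ jointAlgebra 𝕜 T) (m : ℕ) :
    fluxSeq (xDeriv 𝕜) (halfB u) k f l ψ m ∈ jointAlgebra 𝕜 T := by
  induction m with
  | zero => exact zero_mem _
  | succ m ih =>
    have hc := halfB_mem_jointAlgebra hT hu (m + 1)
    have hA := laxSeq_mem_jointAlgebra hT hu hk hf m
    exact add_mem (mul_mem hl ih) (add_mem (sub_mem (mul_mem (xDeriv_mem_jointAlgebra hT hψ) hA)
      (mul_mem hψ (xDeriv_mem_jointAlgebra hT hA)))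
      (mul_mem (mul_mem (mul_mem (ofNat_mem _ 2) hc) hf) hψ))

lemma laxSeq_eq_sum (u l ψ : SliceSmooth 𝕜) (m : ℕ) :
    laxSeq (xDeriv 𝕜) (halfB u) l ψ m = ∑ i ∈ Finset.range (m + 1),
      (2 * halfB u i * xDeriv 𝕜 ψ - xDeriv 𝕜 (halfB u i) * ψ) * l ^ (m - i) := by
  induction m with
  | zero => simp [laxSeq, halfB_zero]
  | succ m ih =>
    rw [laxSeq, ih, Finset.sum_range_succ _ (m + 1), Finset.mul_sum]
    congr 1
    · refine Finset.sum_congr rfl fun i hi => ?_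
      rw [Nat.succ_sub (Finset.mem_range_succ_iff.1 hi), pow_succ]
      ring
    · simp

lemma laxSeq_apply {u ψ : ℝ → ℝ → 𝕜} {U P : SliceSmooth 𝕜} {t : ℝ}
    (hU : ∀ x, U.1 x t = u x t) (hP : ∀ x, P.1 x t = ψ x t) (n : ℕ) (l : 𝕜) (x : ℝ) :
    (laxSeq (xDeriv 𝕜) (halfB U) (algebraMap 𝕜 _ l) P (n + 1)).1 x t = laxA n u l ψ x t := by
  rw [laxSeq_eq_sum]
  change evalAt (𝕜 := 𝕜) x t _ = _
  rw [map_sum, laxA]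
  refine Finset.sum_congr rfl fun i _ => ?_
  have h1 : evalAt x t (2 * halfB U i) = evalDiff (bCoeff i) u x t := by
    rw [two_mul_halfB]; exact evalSlice_apply hU _ _
  have h2 : evalAt x t (xDeriv 𝕜 (halfB U i)) = -evalDiff (aCoeff i) u x t := by
    have h3 := xDeriv_evalSlice (bCoeff i) U
    have h4 : xDeriv 𝕜 (halfB U i) = (1 / 2 : 𝕜) • evalSlice (totalD (bCoeff i)) U := by
      rw [halfB, Derivation.map_smul, h3]
    rw [h4]
    change (1 / 2 : 𝕜) * (evalSlice (totalD (bCoeff i)) U).1 x t = _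
    rw [evalSlice_apply hU, aCoeff, evalDiff, evalDiff, map_smul, Algebra.smul_def]
    simp
  have h5 : evalAt x t (xDeriv 𝕜 P) = dx ψ x t := xDeriv_eq_dx hP x
  have h6 : evalAt x t P = ψ x t := hP x
  have h7 : evalAt x t (algebraMap 𝕜 (SliceSmooth 𝕜) l) = l := rfl
  rw [map_mul, map_sub, map_mul (evalAt x t) (2 * halfB U i),
    map_mul (evalAt x t) (xDeriv 𝕜 (halfB U i)), map_pow, h1, h2, h5, h6, h7]
  ring

end JointAlgebra

section Setting

variable {𝕜 : Type*} [RCLike 𝕜] {T : Set ℝ} {κ μ ν : 𝕜} {u f ψ p q : ℝ → ℝ → 𝕜}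

lemma BoundedAtNegInf.restrictTime_mem (hT : IsOpen T) (hb : BoundedAtNegInf T u)
    {hu : ∀ t ∈ T, ContDiff ℝ ∞ (fun x => u x t)} {t₀ : ℝ} (ht₀ : t₀ ∈ T) :
    restrictTime T u hu ∈ bddAlgebra 𝕜 (atBot ×ˢ 𝓝 t₀) := by
  refine mem_bddAlgebra_of_iterate fun k => ?_
  obtain ⟨V, hV, C, hC⟩ := hb k t₀ ht₀
  have hev : ∀ᶠ z : ℝ × ℝ in atBot ×ˢ 𝓝 t₀, z.1 ≤ 0 ∧ z.2 ∈ V ∩ T :=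
    (eventually_le_atBot 0).prod_mk (inter_mem hV (hT.mem_nhds ht₀))
  refine IsBigO.of_bound C (hev.mono fun z hz => ?_)
  rw [iterate_xDeriv_apply,
    show (fun y => (restrictTime T u hu).1 y z.2) = fun y => u y z.2 from
      funext fun y => restrictTime_apply hu hz.2.2 y]
  simpa using hC z.2 hz.2.1 z.1 hz.1

lemma xDeriv_apply_eq_zero {g : SliceSmooth 𝕜} {t : ℝ} (h : ∀ x, g.1 x t = 0) (x : ℝ) :
    (xDeriv 𝕜 g).1 x t = 0 := by
  rw [xDeriv_eq_dx (g := fun _ _ => 0) h]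
  simp [dx]

lemma slice_ext {g h : SliceSmooth 𝕜} (h1 : ∀ x, ∀ t ∈ T, g.1 x t = h.1 x t)
    (h2 : ∀ x, ∀ t ∉ T, g.1 x t = h.1 x t) : g = h :=
  Subtype.ext <| funext fun x => funext fun t => by
    by_cases ht : t ∈ T
    · exact h1 x t ht
    · exact h2 x t ht

/-- A smooth solution of the Schrödinger equation `p_xx + (μ + u) p = 0` for the times in `T`. -/
structure IsWave (T : Set ℝ) (u : ℝ → ℝ → 𝕜) (μ : 𝕜) (p : ℝ → ℝ → 𝕜) : Prop where
  smooth : SmoothOn T p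
  spectral : ∀ x, ∀ t ∈ T, dx (dx p) x t + (μ + u x t) * p x t = 0

/-- The wave function as an element of the differential algebra. -/
def IsWave.elt (h : IsWave T u μ p) : SliceSmooth 𝕜 :=
  restrictTime T p fun _ ht => h.smooth.contDiff_slice ht

lemma IsWave.elt_apply (h : IsWave T u μ p) (x : ℝ) {t : ℝ} (ht : t ∈ T) :
    h.elt.1 x t = p x t := restrictTime_apply _ ht x

lemma IsWave.elt_apply_of_notMem (h : IsWave T u μ p) (x : ℝ) {t : ℝ} (ht : t ∉ T) :
    h.elt.1 x t = 0 := restrictTime_apply_of_notMem _ ht x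

lemma IsWave.elt_mem (h : IsWave T u μ p) : h.elt ∈ jointAlgebra 𝕜 T :=
  h.smooth.congr fun x _ ht => h.elt_apply x ht

lemma IsWave.xDeriv_xDeriv (h : IsWave T u μ p) {U : SliceSmooth 𝕜}
    (hU : ∀ x, ∀ t ∈ T, U.1 x t = u x t) :
    xDeriv 𝕜 (xDeriv 𝕜 h.elt) = -(algebraMap 𝕜 _ μ + U) * h.elt := by
  refine slice_ext (T := T) (fun x t ht => ?_) fun x t ht => ?_
  · have h1 := h.spectral x t ht
    have h2 : (xDeriv 𝕜 (xDeriv 𝕜 h.elt)).1 x t = dx (dx p) x t :=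
      xDeriv_eq_dx (fun y => xDeriv_eq_dx (fun z => h.elt_apply z ht) y) x
    change _ = -(μ + U.1 x t) * h.elt.1 x t
    rw [h2, hU x t ht, h.elt_apply x ht]
    linear_combination h1
  · rw [xDeriv_apply_eq_zero (fun y => xDeriv_apply_eq_zero
      (fun z => h.elt_apply_of_notMem z ht) y) x]
    change _ = -(μ + U.1 x t) * h.elt.1 x t
    rw [h.elt_apply_of_notMem x ht, mul_zero]

lemma contDiff_intX_mul (hp : SmoothOn T p) (hq : SmoothOn T q) (h : ProductDecays T p q) :
    ∀ t ∈ T, ContDiff ℝ ∞ (fun x => intX (fun y s => p y s * q y s) x t) :=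
  fun _ ht => h.dominated.contDiff_intX ht ((hp.contDiff_slice ht).mul (hq.contDiff_slice ht))

lemma hasDerivAt_intX_mul (hp : SmoothOn T p) (hq : SmoothOn T q) (h : ProductDecays T p q)
    (x : ℝ) {t : ℝ} (ht : t ∈ T) :
    HasDerivAt (fun y => intX (fun y s => p y s * q y s) y t) (p x t * q x t) x :=
  h.dominated.hasDerivAt_intX ht
    ((hp.contDiff_slice ht).mul (hq.contDiff_slice ht)).continuous x

lemma tendsto_slice {g : ℝ → ℝ → 𝕜} {c : 𝕜} {t : ℝ}
    (h : Tendsto (fun z : ℝ × ℝ => g z.1 z.2) (atBot ×ˢ 𝓝 t) (𝓝 c)) :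
    Tendsto (fun x => g x t) atBot (𝓝 c) :=
  h.comp (tendsto_id.prodMk (tendsto_const_nhds (x := t)))

/-- `∂⁻¹(p q)` as an element of the differential algebra. -/
def intElt (hp : SmoothOn T p) (hq : SmoothOn T q) (h : ProductDecays T p q) : SliceSmooth 𝕜 :=
  restrictTime T (intX fun y s => p y s * q y s) (contDiff_intX_mul hp hq h)

lemma intElt_apply (hp : SmoothOn T p) (hq : SmoothOn T q) (h : ProductDecays T p q) (x : ℝ)
    {t : ℝ} (ht : t ∈ T) : (intElt hp hq h).1 x t = intX (fun y s => p y s * q y s) x t :=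
  restrictTime_apply _ ht x

lemma IsWave.xDeriv_intElt (hp : IsWave T u μ p) (hq : IsWave T u ν q) (h : ProductDecays T p q) :
    xDeriv 𝕜 (intElt hp.smooth hq.smooth h) = hp.elt * hq.elt := by
  refine slice_ext (T := T) (fun x t ht => ?_) fun x t ht => ?_
  · rw [xDeriv_eq_dx (fun y => intElt_apply _ _ h y ht)]
    change _ = hp.elt.1 x t * hq.elt.1 x t
    rw [hp.elt_apply x ht, hq.elt_apply x ht]
    exact (hasDerivAt_intX_mul hp.smooth hq.smooth h x ht).deriv
  · rw [intElt, xDeriv_apply_eq_zero fun y => restrictTime_apply_of_notMem _ ht y]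
    change _ = hp.elt.1 x t * hq.elt.1 x t
    rw [hp.elt_apply_of_notMem x ht, zero_mul]

/-- The integral of a product of two wave functions in terms of their Wronskian. -/
lemma IsWave.wronskian (hT : IsOpen T) (hu : ∀ t ∈ T, ContDiff ℝ ∞ (fun x => u x t))
    (hp : IsWave T u μ p) (hq : IsWave T u ν q) (h : ProductDecays T p q) :
    (algebraMap 𝕜 _ ν - algebraMap 𝕜 _ μ) * intElt hp.smooth hq.smooth h
      = xDeriv 𝕜 hp.elt * hq.elt - hp.elt * xDeriv 𝕜 hq.elt := by
  have hU := fun x t (ht : t ∈ T) => restrictTime_apply (g := u) hu ht x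
  obtain ⟨g, hg⟩ : ∃ g, g = (algebraMap 𝕜 _ ν - algebraMap 𝕜 _ μ) * intElt hp.smooth hq.smooth h
    - (xDeriv 𝕜 hp.elt * hq.elt - hp.elt * xDeriv 𝕜 hq.elt) := ⟨_, rfl⟩
  have hD : xDeriv 𝕜 g = 0 := by
    rw [hg]
    simp only [map_sub, Derivation.leibniz, Derivation.map_algebraMap, hp.xDeriv_intElt hq,
      hp.xDeriv_xDeriv hU, hq.xDeriv_xDeriv hU, smul_eq_mul]
    ring
  rw [← sub_eq_zero, ← hg]
  refine slice_ext (T := T) (fun x t ht => ?_) fun x t ht => ?_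
  · refine eq_zero_of_xDeriv_eq_zero (fun y => by rw [hD]; rfl) (tendsto_slice ?_) x
    have hn := h.nullProducts hT (P := hp.elt) (Q := hq.elt) (fun x t ht => hp.elt_apply x ht)
      (fun x t ht => hq.elt_apply x ht) ht
    have hs : Tendsto (fun z : ℝ × ℝ => (intElt hp.smooth hq.smooth h).1 z.1 z.2)
        (atBot ×ˢ 𝓝 t) (𝓝 0) := by
      refine (h.dominated.tendsto_intX ht).congr' ?_
      filter_upwards [(eventually_of_mem (hT.mem_nhds ht) fun t ht => ht :
        ∀ᶠ s in 𝓝 t, s ∈ T).prod_inr atBot] with z hz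
      exact (intElt_apply _ _ h z.1 hz).symm
    have := (hs.const_mul (ν - μ)).sub (hn.deriv_mul.sub hn.mul_deriv)
    simp only [mul_zero, sub_zero] at this
    rw [hg]
    exact this
  · rw [hg]
    change (ν - μ) * (intElt hp.smooth hq.smooth h).1 x t
      - ((xDeriv 𝕜 hp.elt).1 x t * hq.elt.1 x t - hp.elt.1 x t * (xDeriv 𝕜 hq.elt).1 x t) = 0
    rw [hp.elt_apply_of_notMem x ht, hq.elt_apply_of_notMem x ht, intElt,
      restrictTime_apply_of_notMem _ ht]
    ring

lemma IsWave.smoothOn_intX_of_ne (hT : IsOpen T) (hu : ∀ t ∈ T, ContDiff ℝ ∞ (fun x => u x t))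
    (hp : IsWave T u μ p) (hq : IsWave T u ν q) (h : ProductDecays T p q) (hne : μ ≠ ν) :
    SmoothOn T (intX fun y s => p y s * q y s) := by
  have hW : SmoothOn T (xDeriv 𝕜 hp.elt * hq.elt - hp.elt * xDeriv 𝕜 hq.elt).1 :=
    sub_mem (mul_mem (xDeriv_mem_jointAlgebra hT hp.elt_mem) hq.elt_mem)
      (mul_mem hp.elt_mem (xDeriv_mem_jointAlgebra hT hq.elt_mem))
  refine ((smoothOn_const (ν - μ)⁻¹).mul hW).congr fun x t ht => ?_
  rw [← hp.wronskian hT hu hq h]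
  change _ = (ν - μ)⁻¹ * ((ν - μ) * (intElt hp.smooth hq.smooth h).1 x t)
  rw [inv_mul_cancel_left₀ (sub_ne_zero.2 hne.symm), intElt_apply _ _ h x ht]

end Setting

/-! ### The transformation at a fixed time -/

section Seed

variable {𝕜 : Type*} [RCLike 𝕜] {T : Set ℝ} {κ μ ν : 𝕜} {u f p q : ℝ → ℝ → 𝕜}

/-- The data at fixed times that the binary Darboux transformation is made of: a bounded potential
`u` and a decaying wave function `f` with parameter `κ`, such that `1 + ∂⁻¹ f²` has no zero. -/
structure DarbouxSeed (T : Set ℝ) (κ : 𝕜) (u f : ℝ → ℝ → 𝕜) : Prop where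
  isOpen : IsOpen T
  smooth_u : SmoothOn T u
  bounded : BoundedAtNegInf T u
  wave : IsWave T u κ f
  decay : ProductDecays T f f
  tau_ne : ∀ x, ∀ t ∈ T, tau f x t ≠ 0

lemma tau_eq (f : ℝ → ℝ → 𝕜) : tau f = fun x t => 1 + intX (fun y s => f y s * f y s) x t := by
  funext x t
  simp only [tau, pow_two]

lemma tendsto_pure_of_slice {g : SliceSmooth 𝕜} {t : ℝ} (h : ∀ x, g.1 x t = 0) :
    Tendsto (fun z : ℝ × ℝ => g.1 z.1 z.2) (atBot ×ˢ pure t) (𝓝 0) := by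
  refine tendsto_const_nhds.congr' ?_
  filter_upwards [(eventually_pure.2 rfl : ∀ᶠ s in pure t, s = t).prod_inr atBot] with z hz
  rw [hz, h]

lemma eventually_mem_time (hT : IsOpen T) {t : ℝ} (ht : t ∈ T) :
    ∀ᶠ z : ℝ × ℝ in atBot ×ˢ 𝓝 t, z.2 ∈ T :=
  (eventually_of_mem (hT.mem_nhds ht) fun _ hs => hs : ∀ᶠ s in 𝓝 t, s ∈ T).prod_inr atBot

namespace DarbouxSeed

lemma contDiff_u (h : DarbouxSeed T κ u f) : ∀ t ∈ T, ContDiff ℝ ∞ (fun x => u x t) :=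
  fun _ ht => h.smooth_u.contDiff_slice ht

lemma hasDerivAt_tau (h : DarbouxSeed T κ u f) (x : ℝ) {t : ℝ} (ht : t ∈ T) :
    HasDerivAt (fun y => tau f y t) (f x t * f x t) x := by
  rw [tau_eq]
  exact (hasDerivAt_intX_mul h.wave.smooth h.wave.smooth h.decay x ht).const_add 1

lemma contDiff_inv_tau (h : DarbouxSeed T κ u f) :
    ∀ t ∈ T, ContDiff ℝ ∞ (fun x => (tau f x t)⁻¹) := by
  intro t ht
  refine ContDiff.inv ?_ fun x => h.tau_ne x t ht
  rw [tau_eq]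
  exact contDiff_const.add (contDiff_intX_mul h.wave.smooth h.wave.smooth h.decay t ht)

lemma tendsto_tau (h : DarbouxSeed T κ u f) {t : ℝ} (ht : t ∈ T) :
    Tendsto (fun z : ℝ × ℝ => tau f z.1 z.2) (atBot ×ˢ 𝓝 t) (𝓝 1) := by
  rw [tau_eq]
  simpa using (h.decay.dominated.tendsto_intX ht).const_add 1

lemma isBigO_inv_tau (h : DarbouxSeed T κ u f) {t : ℝ} (ht : t ∈ T) :
    (fun z : ℝ × ℝ => (tau f z.1 z.2)⁻¹) =O[atBot ×ˢ 𝓝 t] (fun _ => (1 : ℝ)) :=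
  ((h.tendsto_tau ht).inv₀ one_ne_zero).isBigO_one ℝ

/-- The potential `u` as an element of the differential algebra. -/
def potElt (h : DarbouxSeed T κ u f) : SliceSmooth 𝕜 := restrictTime T u h.contDiff_u

/-- `1 / τ` as an element of the differential algebra. -/
def invElt (h : DarbouxSeed T κ u f) : SliceSmooth 𝕜 :=
  restrictTime T (fun x t => (tau f x t)⁻¹) h.contDiff_inv_tau

/-- The transformed potential as an element of the differential algebra. -/
def newPot (h : DarbouxSeed T κ u f) : SliceSmooth 𝕜 :=
  h.potElt + 2 * xDeriv 𝕜 (h.wave.elt ^ 2 * h.invElt)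

lemma potElt_apply (h : DarbouxSeed T κ u f) (x t : ℝ) (ht : t ∈ T) :
    h.potElt.1 x t = u x t := restrictTime_apply _ ht x

lemma invElt_apply (h : DarbouxSeed T κ u f) (x : ℝ) {t : ℝ} (ht : t ∈ T) :
    h.invElt.1 x t = (tau f x t)⁻¹ := restrictTime_apply h.contDiff_inv_tau ht x

lemma invElt_apply_of_notMem (h : DarbouxSeed T κ u f) (x : ℝ) {t : ℝ} (ht : t ∉ T) :
    h.invElt.1 x t = 0 := restrictTime_apply_of_notMem h.contDiff_inv_tau ht x

lemma xDeriv_invElt (h : DarbouxSeed T κ u f) :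
    xDeriv 𝕜 h.invElt = -(h.wave.elt ^ 2 * h.invElt ^ 2) := by
  refine slice_ext (T := T) (fun x t ht => ?_) fun x t ht => ?_
  · rw [xDeriv_eq_dx (g := fun x t => (tau f x t)⁻¹) fun y => h.invElt_apply y ht]
    change _ = -(h.wave.elt.1 x t ^ 2 * h.invElt.1 x t ^ 2)
    rw [h.wave.elt_apply x ht, h.invElt_apply x ht]
    refine ((h.hasDerivAt_tau x ht).fun_inv (h.tau_ne x t ht)).deriv.trans ?_
    rw [inv_pow, div_eq_mul_inv]
    ring
  · rw [xDeriv_apply_eq_zero fun y => h.invElt_apply_of_notMem y ht]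
    change _ = -(h.wave.elt.1 x t ^ 2 * h.invElt.1 x t ^ 2)
    rw [h.invElt_apply_of_notMem x ht]
    simp

lemma newPot_apply (h : DarbouxSeed T κ u f) (x t : ℝ) (ht : t ∈ T) :
    h.newPot.1 x t = darbouxPotential u f x t := by
  have e : logDeriv (fun y => tau f y t) = fun y => (h.wave.elt ^ 2 * h.invElt).1 y t := by
    funext y
    change _ = h.wave.elt.1 y t ^ 2 * h.invElt.1 y t
    rw [logDeriv_apply, (h.hasDerivAt_tau y ht).deriv, h.wave.elt_apply y ht, h.invElt_apply y ht,
      div_eq_mul_inv, pow_two]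
  rw [darbouxPotential, e]
  change h.potElt.1 x t + _ = _
  rw [h.potElt_apply x t ht]
  rfl

lemma potElt_mem (h : DarbouxSeed T κ u f) {t : ℝ} (ht : t ∈ T) :
    h.potElt ∈ bddAlgebra 𝕜 (atBot ×ˢ 𝓝 t) := h.bounded.restrictTime_mem h.isOpen ht

lemma nullProducts (h : DarbouxSeed T κ u f) {t : ℝ} (ht : t ∈ T) :
    NullProducts (atBot ×ˢ 𝓝 t) h.wave.elt h.wave.elt :=
  h.decay.nullProducts h.isOpen (fun x _ ht => h.wave.elt_apply x ht)
    (fun x _ ht => h.wave.elt_apply x ht) ht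

lemma isBigO_invElt (h : DarbouxSeed T κ u f) {t : ℝ} (ht : t ∈ T) :
    (fun z : ℝ × ℝ => h.invElt.1 z.1 z.2) =O[atBot ×ˢ 𝓝 t] (fun _ => (1 : ℝ)) := by
  refine (h.isBigO_inv_tau ht).congr' ?_ EventuallyEq.rfl
  filter_upwards [eventually_mem_time h.isOpen ht] with z hz
  exact (h.invElt_apply z.1 hz).symm

/-- The coefficients `b_{m+1}[ū] / 2` of the hierarchy for the transformed potential. -/
lemma halfB_newPot (h : DarbouxSeed T κ u f) (m : ℕ) :
    2 * halfB h.newPot (m + 1) = 2 * halfB h.potElt (m + 1)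
      - xDeriv 𝕜 (fluxSeq (xDeriv 𝕜) (halfB h.potElt) (algebraMap 𝕜 _ κ) h.wave.elt
          (algebraMap 𝕜 _ κ) h.wave.elt m * h.invElt) := by
  have hle : ∀ t : ℝ, (atBot : Filter ℝ) ×ˢ pure t ≤ atBot ×ˢ 𝓝 t :=
    fun t => prod_mono_right _ (pure_le_nhds t)
  have hf0 : ∀ t ∉ T, ∀ x, h.wave.elt.1 x t = 0 := fun t ht x => h.wave.elt_apply_of_notMem x ht
  refine halfB_transformed (Derivation.map_algebraMap _ _) (h.wave.xDeriv_xDeriv h.potElt_apply)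
    h.xDeriv_invElt rfl (fun t => ?_) (fun t => (bddAlgebra 𝕜 _).algebraMap_mem _) (fun t => ?_)
    (fun t => ?_) m
  · by_cases ht : t ∈ T
    · exact bddAlgebra_mono (hle t) (h.potElt_mem ht)
    · refine mem_bddAlgebra_of_iterate fun k => (tendsto_pure_of_slice fun x => ?_).isBigO_one ℝ
      rw [iterate_xDeriv_apply, show (fun y => h.potElt.1 y t) = fun _ => 0 from
        funext fun y => restrictTime_apply_of_notMem _ ht y]
      simp
  · by_cases ht : t ∈ T
    · exact (h.nullProducts ht).mono (hle t)
    · have hz : ∀ g k : SliceSmooth 𝕜, (∀ x, g.1 x t = 0) → ∀ x, (g * k).1 x t = 0 :=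
        fun g k hg x => by
          change g.1 x t * k.1 x t = 0
          rw [hg, zero_mul]
      have h0 := hf0 t ht
      have h1 := xDeriv_apply_eq_zero h0
      exact ⟨tendsto_pure_of_slice (hz _ _ h0), tendsto_pure_of_slice (hz _ _ h1),
        tendsto_pure_of_slice (hz _ _ h0), tendsto_pure_of_slice (hz _ _ h1)⟩
  · by_cases ht : t ∈ T
    · exact (h.isBigO_invElt ht).mono (hle t)
    · exact (tendsto_pure_of_slice fun x => h.invElt_apply_of_notMem x ht).isBigO_one ℝ

lemma newPot_mem (h : DarbouxSeed T κ u f) {t : ℝ} (ht : t ∈ T) :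
    h.newPot ∈ bddAlgebra 𝕜 (atBot ×ˢ 𝓝 t) := by
  have h1 := (potential_sub_mem_nullModule (h.wave.xDeriv_xDeriv h.potElt_apply) h.xDeriv_invElt
    (v := h.newPot) rfl (h.potElt_mem ht) ((bddAlgebra 𝕜 _).algebraMap_mem κ) (h.nullProducts ht)
    (h.isBigO_invElt ht)).2
  simpa using add_mem (nullModule_le_bddAlgebra h1) (h.potElt_mem ht)

lemma invElt_mem (h : DarbouxSeed T κ u f) (hτ : SmoothOn T (tau f)) :
    h.invElt ∈ jointAlgebra 𝕜 T :=
  (hτ.inv h.tau_ne).congr fun x _ ht => h.invElt_apply x ht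

lemma newPot_mem_jointAlgebra (h : DarbouxSeed T κ u f) (hτ : SmoothOn T (tau f)) :
    h.newPot ∈ jointAlgebra 𝕜 T := by
  have hU : h.potElt ∈ jointAlgebra 𝕜 T := h.smooth_u.congr fun x t ht => h.potElt_apply x t ht
  exact add_mem hU (mul_mem (ofNat_mem _ 2) (xDeriv_mem_jointAlgebra h.isOpen
    (mul_mem (pow_mem h.wave.elt_mem 2) (h.invElt_mem hτ))))

lemma smoothOn_darbouxPotential (h : DarbouxSeed T κ u f) (hτ : SmoothOn T (tau f)) :
    SmoothOn T (darbouxPotential u f) :=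
  SmoothOn.congr (h.newPot_mem_jointAlgebra hτ) fun x t ht => (h.newPot_apply x t ht).symm

lemma boundedAtNegInf_darbouxPotential (h : DarbouxSeed T κ u f) (hτ : SmoothOn T (tau f)) :
    BoundedAtNegInf T (darbouxPotential u f) := by
  intro k t ht
  obtain ⟨V, hV, C, hC⟩ := locBounded_of_isBigO h.isOpen
    (iterate_xDeriv_mem_jointAlgebra h.isOpen (h.newPot_mem_jointAlgebra hτ) k)
    (fun t ht => (iterate_xDeriv_mem_bddAlgebra (h.newPot_mem ht) k 0).isBigO) t ht
  refine ⟨V ∩ T, inter_mem hV (h.isOpen.mem_nhds ht), C, fun s hs x hx => ?_⟩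
  have := hC s hs.1 x hx
  rwa [iterate_xDeriv_apply, show (fun y => h.newPot.1 y s) = fun y => darbouxPotential u f y s from
    funext fun y => h.newPot_apply y s hs.2] at this

/-! ### Transformed wave functions -/

/-- The transform of a wave function as an element of the differential algebra. -/
def newWave (h : DarbouxSeed T κ u f) (hp : IsWave T u μ p) (hfp : ProductDecays T f p) :
    SliceSmooth 𝕜 :=
  hp.elt - h.wave.elt * h.invElt * intElt h.wave.smooth hp.smooth hfp

lemma newWave_apply (h : DarbouxSeed T κ u f) (hp : IsWave T u μ p) (hfp : ProductDecays T f p)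
    (x : ℝ) {t : ℝ} (ht : t ∈ T) : (h.newWave hp hfp).1 x t = darbouxWave f p x t := by
  change hp.elt.1 x t - h.wave.elt.1 x t * h.invElt.1 x t * (intElt _ _ hfp).1 x t = _
  rw [hp.elt_apply x ht, h.wave.elt_apply x ht, h.invElt_apply x ht, intElt_apply _ _ hfp x ht,
    darbouxWave, div_eq_mul_inv]

lemma smoothOn_darbouxWave (h : DarbouxSeed T κ u f) (hp : SmoothOn T p)
    (hτ : SmoothOn T (tau f)) (hs : SmoothOn T (intX fun y s => f y s * p y s)) :
    SmoothOn T (darbouxWave f p) :=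
  (hp.sub ((h.wave.smooth.mul (hτ.inv h.tau_ne)).mul hs)).congr fun x t _ => by
    rw [darbouxWave, div_eq_mul_inv]

lemma darbouxWave_spectral (h : DarbouxSeed T κ u f) (hp : IsWave T u μ p)
    (hfp : ProductDecays T f p) (x t : ℝ) (ht : t ∈ T) :
    dx (dx (darbouxWave f p)) x t + (μ + darbouxPotential u f x t) * darbouxWave f p x t = 0 := by
  have key := schrodinger_transformed (h.wave.xDeriv_xDeriv h.potElt_apply) h.xDeriv_invElt
    (hp.xDeriv_xDeriv h.potElt_apply) (h.wave.xDeriv_intElt hp hfp)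
    (h.wave.wronskian h.isOpen h.contDiff_u hp hfp) (v := h.newPot) rfl
  have e : (xDeriv 𝕜 (xDeriv 𝕜 (h.newWave hp hfp))).1 x t = dx (dx (darbouxWave f p)) x t :=
    xDeriv_eq_dx (fun y => xDeriv_eq_dx (fun z => h.newWave_apply hp hfp z ht) y) x
  rw [← e, ← h.newWave_apply hp hfp x ht, ← h.newPot_apply x t ht, newWave, key]
  change -(μ + h.newPot.1 x t) * (h.newWave hp hfp).1 x t
    + (μ + h.newPot.1 x t) * (h.newWave hp hfp).1 x t = 0
  ring

lemma hasDerivAt_darbouxWave (h : DarbouxSeed T κ u f) (hp : SmoothOn T p)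
    (hfp : ProductDecays T f p) (x : ℝ) {t : ℝ} (ht : t ∈ T) :
    HasDerivAt (fun y => darbouxWave f p y t)
      (dx p x t - ((dx f x t * tau f x t - f x t * (f x t * f x t)) / tau f x t ^ 2
        * intX (fun y s => f y s * p y s) x t + f x t / tau f x t * (f x t * p x t))) x :=
  (hp.hasDerivAt_dx h.isOpen ht).sub
    (((h.wave.smooth.hasDerivAt_dx h.isOpen ht).div (h.hasDerivAt_tau x ht) (h.tau_ne x t ht)).mul
      (hasDerivAt_intX_mul h.wave.smooth hp hfp x ht))

/-- The transform of `p` and its `x`-derivative are combinations of `p, p_x, f, f_x` with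
coefficients that are bounded on `x ≤ 0`. -/
lemma darbouxWave_bound (h : DarbouxSeed T κ u f) (hp : IsWave T u μ p)
    (hfp : ProductDecays T f p) (hτ : SmoothOn T (tau f))
    (hs : SmoothOn T (intX fun y s => f y s * p y s)) :
    ∀ t₀ ∈ T, ∃ V ∈ 𝓝 t₀, ∃ C : ℝ, ∀ t ∈ V, ∀ x ≤ 0,
      ‖darbouxWave f p x t‖ ≤ C * (‖p x t‖ + ‖dx p x t‖ + ‖f x t‖ + ‖dx f x t‖) ∧
      ‖dx (darbouxWave f p) x t‖ ≤ C * (‖p x t‖ + ‖dx p x t‖ + ‖f x t‖ + ‖dx f x t‖) := by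
  set s := intX fun y s => f y s * p y s with hsdef
  have hI := hτ.inv h.tau_ne
  have hfs := h.wave.smooth
  have hc₁ : LocBounded T (fun x t => (tau f x t)⁻¹ * s x t) :=
    locBounded_of_isBigO h.isOpen (hI.mul hs) fun t ht =>
      (tendsto_zero_mul_of_isBigO (h.isBigO_inv_tau ht)
        (hfp.dominated.tendsto_intX ht)).isBigO_one ℝ
  have hc₂ : LocBounded T (fun x t => f x t * f x t * ((tau f x t)⁻¹ * ((tau f x t)⁻¹ * s x t))
      - (tau f x t)⁻¹ * (f x t * p x t)) := by
    refine locBounded_of_isBigO h.isOpen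
      (((hfs.mul hfs).mul (hI.mul (hI.mul hs))).sub (hI.mul (hfs.mul hp.smooth))) fun t ht => ?_
    have hff : Tendsto (fun z : ℝ × ℝ => f z.1 z.2 * f z.1 z.2) (atBot ×ˢ 𝓝 t) (𝓝 0) := by
      refine (h.nullProducts ht).mul.congr' ?_
      filter_upwards [eventually_mem_time h.isOpen ht] with z hz
      change h.wave.elt.1 z.1 z.2 * h.wave.elt.1 z.1 z.2 = _
      rw [h.wave.elt_apply _ hz]
    have hfp' : Tendsto (fun z : ℝ × ℝ => f z.1 z.2 * p z.1 z.2) (atBot ×ˢ 𝓝 t) (𝓝 0) := by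
      refine (hfp.nullProducts h.isOpen (fun x _ ht => h.wave.elt_apply x ht)
        (fun x _ ht => hp.elt_apply x ht) ht).mul.congr' ?_
      filter_upwards [eventually_mem_time h.isOpen ht] with z hz
      change h.wave.elt.1 z.1 z.2 * hp.elt.1 z.1 z.2 = _
      rw [h.wave.elt_apply _ hz, hp.elt_apply _ hz]
    have hB := h.isBigO_inv_tau ht
    have hS := tendsto_zero_mul_of_isBigO hB (tendsto_zero_mul_of_isBigO hB
      (hfp.dominated.tendsto_intX ht))
    exact ((tendsto_zero_mul_of_isBigO (hff.isBigO_one ℝ) hS).sub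
      (tendsto_zero_mul_of_isBigO hB hfp')).isBigO_one ℝ
  intro t₀ ht₀
  obtain ⟨V₁, hV₁, C₁, hC₁⟩ := hc₁ t₀ ht₀
  obtain ⟨V₂, hV₂, C₂, hC₂⟩ := hc₂ t₀ ht₀
  refine ⟨V₁ ∩ V₂ ∩ T, inter_mem (inter_mem hV₁ hV₂) (h.isOpen.mem_nhds ht₀), 1 + |C₁| + |C₂|, ?_⟩
  rintro t ⟨⟨h1, h2⟩, ht⟩ x hx
  have b1 := (hC₁ t h1 x hx).trans (le_abs_self _)
  have b2 := (hC₂ t h2 x hx).trans (le_abs_self _)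
  have hτ0 := h.tau_ne x t ht
  set c₁ := (tau f x t)⁻¹ * s x t with hc₁def
  set c₂ := f x t * f x t * ((tau f x t)⁻¹ * c₁) - (tau f x t)⁻¹ * (f x t * p x t) with hc₂def
  have e1 : darbouxWave f p x t = p x t - c₁ * f x t := by
    rw [darbouxWave, hc₁def, div_eq_mul_inv]; ring
  have e2 : dx (darbouxWave f p) x t = dx p x t - c₁ * dx f x t + c₂ * f x t := by
    rw [dx, (h.hasDerivAt_darbouxWave hp.smooth hfp x ht).deriv, hc₂def, hc₁def, hsdef]
    field_simp
    ring
  have n1 := norm_nonneg (p x t)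
  have n2 := norm_nonneg (dx p x t)
  have n3 := norm_nonneg (f x t)
  have n4 := norm_nonneg (dx f x t)
  have a1 := abs_nonneg C₁
  have a2 := abs_nonneg C₂
  have m1 := mul_nonneg a1 n1
  have m2 := mul_nonneg a1 n2
  have m3 := mul_nonneg a1 n3
  have m4 := mul_nonneg a1 n4
  have l1 := mul_nonneg a2 n1
  have l2 := mul_nonneg a2 n2
  have l3 := mul_nonneg a2 n3
  have l4 := mul_nonneg a2 n4
  have k1 : ‖c₁ * f x t‖ ≤ |C₁| * ‖f x t‖ := by rw [norm_mul]; gcongr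
  have k2 : ‖c₁ * dx f x t‖ ≤ |C₁| * ‖dx f x t‖ := by rw [norm_mul]; gcongr
  have k3 : ‖c₂ * f x t‖ ≤ |C₂| * ‖f x t‖ := by rw [norm_mul]; gcongr
  constructor
  · rw [e1]
    have := norm_sub_le (p x t) (c₁ * f x t)
    linarith
  · rw [e2]
    have := norm_add_le (dx p x t - c₁ * dx f x t) (c₂ * f x t)
    have := norm_sub_le (dx p x t) (c₁ * dx f x t)
    linarith

/-- Transformed wave functions have decaying products if the original ones have. -/
lemma productDecays_darbouxWave (h : DarbouxSeed T κ u f) (hp : IsWave T u μ p)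
    (hq : IsWave T u ν q) (hpq : ProductDecays T p q) (hfp : ProductDecays T f p)
    (hfq : ProductDecays T f q) (hτ : SmoothOn T (tau f))
    (hsp : SmoothOn T (intX fun y s => f y s * p y s))
    (hsq : SmoothOn T (intX fun y s => f y s * q y s)) :
    ProductDecays T (darbouxWave f p) (darbouxWave f q) :=
  productDecays_of_le hpq hfp.symm hfq h.decay (h.darbouxWave_bound hp hfp hτ hsp)
    (h.darbouxWave_bound hq hfq hτ hsq)

/-- `∂⁻¹(p̄ q̄) = ∂⁻¹(p q) - ∂⁻¹(f p) ∂⁻¹(f q) / τ`. -/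
lemma intX_darbouxWave_mul (h : DarbouxSeed T κ u f) (hp : SmoothOn T p) (hq : SmoothOn T q)
    (hpq : ProductDecays T p q) (hfp : ProductDecays T f p) (hfq : ProductDecays T f q)
    (hd : ProductDecays T (darbouxWave f p) (darbouxWave f q)) (x : ℝ) {t : ℝ} (ht : t ∈ T) :
    intX (fun y s => darbouxWave f p y s * darbouxWave f q y s) x t
      = intX (fun y s => p y s * q y s) x t
        - intX (fun y s => f y s * p y s) x t * intX (fun y s => f y s * q y s) x t
          / tau f x t := by
  have hD : ∀ {p : ℝ → ℝ → 𝕜}, SmoothOn T p → ProductDecays T f p →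
      Continuous fun y => darbouxWave f p y t := fun hp hfp =>
    continuous_iff_continuousAt.2 fun y => (h.hasDerivAt_darbouxWave hp hfp y ht).continuousAt
  refine hd.dominated.intX_eq ht ((hD hp hfp).mul (hD hq hfq)) (s := fun x =>
    intX (fun y s => p y s * q y s) x t
        - intX (fun y s => f y s * p y s) x t * intX (fun y s => f y s * q y s) x t
          / tau f x t) (fun y => ?_) ?_ x
  · have hτ0 := h.tau_ne y t ht
    refine ((hasDerivAt_intX_mul hp hq hpq y ht).sub
      (((hasDerivAt_intX_mul h.wave.smooth hp hfp y ht).mul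
        (hasDerivAt_intX_mul h.wave.smooth hq hfq y ht)).div (h.hasDerivAt_tau y ht) hτ0)).congr_deriv
      ?_
    rw [darbouxWave, darbouxWave]
    simp only [Pi.mul_apply]
    field_simp
    ring
  · have h1 := tendsto_slice (hpq.dominated.tendsto_intX ht)
    have h2 := tendsto_slice (hfp.dominated.tendsto_intX ht)
    have h3 := tendsto_slice (hfq.dominated.tendsto_intX ht)
    simpa using h1.sub ((h2.mul h3).div (tendsto_slice (h.tendsto_tau ht)) one_ne_zero)

lemma darbouxWave_self (h : DarbouxSeed T κ u f) (x : ℝ) {t : ℝ} (ht : t ∈ T) :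
    darbouxWave f f x t = f x t / tau f x t := by
  have hτ0 := h.tau_ne x t ht
  have e : intX (fun y s => f y s * f y s) x t = tau f x t - 1 := by rw [tau_eq]; ring
  rw [darbouxWave, e]
  field_simp
  ring

end DarbouxSeed

end Seed

/-! ### Time evolution -/

section TimeEvolution

variable {𝕜 : Type*} [RCLike 𝕜] {T : Set ℝ} {α κ μ : 𝕜} {u f ψ : ℝ → ℝ → 𝕜} {n N : ℕ}
  {lam : Fin N → 𝕜} {φ : Fin N → ℝ → ℝ → 𝕜}

lemma ProductDecays.congr_left (hT : IsOpen T) {p p' q : ℝ → ℝ → 𝕜} (h : ProductDecays T p q)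
    (e : ∀ x, ∀ t ∈ T, p' x t = p x t) : ProductDecays T p' q := fun t₀ ht₀ => by
  obtain ⟨V, hV, G, hG, hl, hb⟩ := h t₀ ht₀
  refine ⟨V ∩ T, inter_mem hV (hT.mem_nhds ht₀), G, hG, hl, fun t ht x hx => ?_⟩
  rw [e x t ht.2, dx_congr e ht.2]
  exact hb t ht.1 x hx

lemma IsLaxSolution.wave {η : 𝕜} (h : IsLaxSolution n N α η T u φ μ ψ) : IsWave T u μ ψ :=
  ⟨h.smooth, h.spectral⟩

lemma evalAt_apply (x t : ℝ) (g : SliceSmooth 𝕜) : evalAt x t g = g.1 x t := rfl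

/-- The flux `∂⁻¹(A(κ)f · ψ + f · A(μ)ψ)` of the source-free part of the Lax pair. -/
def DarbouxSeed.flux (h : DarbouxSeed T κ u f) (n : ℕ) (hψ : IsWave T u μ ψ) : SliceSmooth 𝕜 :=
  fluxSeq (xDeriv 𝕜) (halfB h.potElt) (algebraMap 𝕜 _ κ) h.wave.elt (algebraMap 𝕜 _ μ) hψ.elt
    (n + 1)

lemma DarbouxSeed.hasDerivAt_flux (h : DarbouxSeed T κ u f) (n : ℕ) (hψ : IsWave T u μ ψ) (x : ℝ)
    {t : ℝ} (ht : t ∈ T) : HasDerivAt (fun y => (h.flux n hψ).1 y t)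
      (laxA n u κ f x t * ψ x t + f x t * laxA n u μ ψ x t) x := by
  have key := congrArg (evalAt x t) (fluxSeq_deriv (halfB_zero h.potElt) (halfB_recursion h.potElt)
    (Derivation.map_algebraMap _ κ) (h.wave.xDeriv_xDeriv h.potElt_apply)
    (Derivation.map_algebraMap _ μ) (hψ.xDeriv_xDeriv h.potElt_apply) (n + 1))
  simp only [map_add, map_mul, evalAt_apply] at key
  rw [laxSeq_apply (fun y => h.potElt_apply y t ht) (fun y => h.wave.elt_apply y ht),
    laxSeq_apply (fun y => h.potElt_apply y t ht) (fun y => hψ.elt_apply y ht),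
    h.wave.elt_apply x ht, hψ.elt_apply x ht] at key
  exact key ▸ hasDerivAt_slice (h.flux n hψ) x t

/-- The time derivative of `∂⁻¹(f ψ)` for two solutions of the Lax pair. -/
lemma hasDerivAt_intX_time (h : DarbouxSeed T κ u f) (hφ : ∀ j, IsWave T u (lam j) (φ j))
    (hf : IsLaxSolution n N α (-α / 2) T u φ κ f) (hψ : IsLaxSolution n N α (-α / 2) T u φ μ ψ)
    (hfψ : ProductDecays T f ψ) (x : ℝ) {t : ℝ} (ht : t ∈ T) :
    HasDerivAt (fun s => intX (fun y s => f y s * ψ y s) x s)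
      ((h.flux n hψ.wave).1 x t - α * intX (fun y s => f y s * ψ y s) x t
        + α * ∑ j, intX (fun y s => φ j y s * f y s) x t * intX (fun y s => φ j y s * ψ y s) x t)
      t := by
  refine hfψ.dominated.hasDerivAt_intX_t h.isOpen (hf.smooth.mul hψ.smooth)
    (H := fun x t => (h.flux n hψ.wave).1 x t - α * intX (fun y s => f y s * ψ y s) x t
        + α * ∑ j, intX (fun y s => φ j y s * f y s) x t * intX (fun y s => φ j y s * ψ y s) x t)
    (fun x t ht => ?_) ht ?_ x
  · have hdt : dt (fun x t => f x t * ψ x t) x t = dt f x t * ψ x t + f x t * dt ψ x t :=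
      ((hf.smooth.hasDerivAt_dt h.isOpen ht).mul (hψ.smooth.hasDerivAt_dt h.isOpen ht)).deriv
    have h3 : HasDerivAt (fun x => ∑ j, intX (fun y s => φ j y s * f y s) x t
        * intX (fun y s => φ j y s * ψ y s) x t)
        (∑ j, (φ j x t * f x t * intX (fun y s => φ j y s * ψ y s) x t
          + intX (fun y s => φ j y s * f y s) x t * (φ j x t * ψ x t))) x :=
      HasDerivAt.fun_sum fun j _ =>
        (hasDerivAt_intX_mul (hφ j).smooth hf.smooth (hf.decay j) x ht).mul
          (hasDerivAt_intX_mul (hφ j).smooth hψ.smooth (hψ.decay j) x ht)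
    refine (((h.hasDerivAt_flux n hψ.wave x ht).sub ((hasDerivAt_intX_mul hf.smooth hψ.smooth hfψ x
      ht).const_mul α)).add (h3.const_mul α)).congr_deriv ?_
    rw [hdt, hf.evolution x t ht, hψ.evolution x t ht, Finset.sum_add_distrib]
    have e1 : ∑ j, φ j x t * f x t * intX (fun y s => φ j y s * ψ y s) x t
        = f x t * ∑ j, φ j x t * intX (fun y s => φ j y s * ψ y s) x t := by
      rw [Finset.mul_sum]; exact Finset.sum_congr rfl fun j _ => by ring
    have e2 : ∑ j, intX (fun y s => φ j y s * f y s) x t * (φ j x t * ψ x t)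
        = ψ x t * ∑ j, φ j x t * intX (fun y s => φ j y s * f y s) x t := by
      rw [Finset.mul_sum]; exact Finset.sum_congr rfl fun j _ => by ring
    rw [e1, e2]
    ring
  · have h1 := tendsto_fluxSeq (h.potElt_mem ht) ((bddAlgebra 𝕜 _).algebraMap_mem κ)
      (h.wave.xDeriv_xDeriv h.potElt_apply) ((bddAlgebra 𝕜 _).algebraMap_mem μ)
      (hfψ.nullProducts h.isOpen (fun x _ ht => h.wave.elt_apply x ht)
        (fun x _ ht => hψ.wave.elt_apply x ht) ht) (n + 1)
    have h2 := (hfψ.dominated.tendsto_intX ht).const_mul α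
    have h3 : Tendsto (fun z : ℝ × ℝ => ∑ j, intX (fun y s => φ j y s * f y s) z.1 z.2
        * intX (fun y s => φ j y s * ψ y s) z.1 z.2) (atBot ×ˢ 𝓝 t)
        (𝓝 (∑ _j : Fin N, (0 : 𝕜) * 0)) := tendsto_finsetSum _ fun j _ =>
      ((hf.decay j).dominated.tendsto_intX ht).mul ((hψ.decay j).dominated.tendsto_intX ht)
    simpa [DarbouxSeed.flux] using (h1.sub h2).add (h3.const_mul α)

/-- `∂⁻¹(f ψ)` is smooth in `(x, t)`. If the spectral parameters differ, it is a multiple of a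
Wronskian. If they agree, then the sources have other parameters, and the time derivative of
`∂⁻¹(f ψ)` is given by functions already known to be smooth. -/
lemma smoothOn_intX (h : DarbouxSeed T κ u f) (hφ : ∀ j, IsWave T u (lam j) (φ j))
    (hlam : ∀ j, lam j ≠ κ)
    (hf : IsLaxSolution n N α (-α / 2) T u φ κ f) (hψ : IsLaxSolution n N α (-α / 2) T u φ μ ψ)
    (hfψ : ProductDecays T f ψ) : SmoothOn T (intX fun y s => f y s * ψ y s) := by
  by_cases hne : κ = μ
  · have hU : h.potElt ∈ jointAlgebra 𝕜 T := h.smooth_u.congr fun x t ht => h.potElt_apply x t ht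
    have hQ : SmoothOn T (h.flux n hψ.wave).1 := fluxSeq_mem_jointAlgebra h.isOpen hU
      ((jointAlgebra 𝕜 T).algebraMap_mem κ) h.wave.elt_mem
      ((jointAlgebra 𝕜 T).algebraMap_mem μ) hψ.wave.elt_mem (n + 1)
    have hS : SmoothOn T (fun x t => ∑ j, intX (fun y s => φ j y s * f y s) x t
        * intX (fun y s => φ j y s * ψ y s) x t) := SmoothOn.sum fun j _ =>
      ((hφ j).smoothOn_intX_of_ne h.isOpen h.contDiff_u h.wave (hf.decay j) (hlam j)).mul
        ((hφ j).smoothOn_intX_of_ne h.isOpen h.contDiff_u hψ.wave (hψ.decay j) (hne ▸ hlam j))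
    refine smoothOn_of_linear_partials h.isOpen (-α) (hf.smooth.mul hψ.smooth)
      (hQ.add ((smoothOn_const α).mul hS))
      (fun x t ht => hasDerivAt_intX_mul hf.smooth hψ.smooth hfψ x ht) fun x t ht => ?_
    refine (hasDerivAt_intX_time h hφ hf hψ hfψ x ht).congr_deriv ?_
    ring
  · exact h.wave.smoothOn_intX_of_ne h.isOpen h.contDiff_u hψ.wave hfψ hne

lemma smoothOn_tau (h : DarbouxSeed T κ u f) (hφ : ∀ j, IsWave T u (lam j) (φ j))
    (hlam : ∀ j, lam j ≠ κ) (hf : IsLaxSolution n N α (-α / 2) T u φ κ f) :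
    SmoothOn T (tau f) := by
  rw [tau_eq]
  exact (smoothOn_const 1).add (smoothOn_intX h hφ hlam hf hf h.decay)

lemma hasDerivAt_tau_time (h : DarbouxSeed T κ u f) (hφ : ∀ j, IsWave T u (lam j) (φ j))
    (hf : IsLaxSolution n N α (-α / 2) T u φ κ f) (x : ℝ) {t : ℝ} (ht : t ∈ T) :
    HasDerivAt (fun s => tau f x s) ((h.flux n h.wave).1 x t - α * (tau f x t - 1)
        + α * ∑ j, intX (fun y s => φ j y s * f y s) x t ^ 2) t := by
  have h1 := (hasDerivAt_intX_time h hφ hf hf h.decay x ht).const_add 1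
  rw [tau_eq]
  simpa only [add_sub_cancel_left, pow_two] using h1

lemma intX_mul_comm (p q : ℝ → ℝ → 𝕜) :
    intX (fun y s => p y s * q y s) = intX fun y s => q y s * p y s := by
  simp only [mul_comm]

lemma laxA_darbouxWave (h : DarbouxSeed T κ u f) (hψ : IsWave T u μ ψ) (hfψ : ProductDecays T f ψ)
    (x : ℝ) {t : ℝ} (ht : t ∈ T) :
    laxA n (darbouxPotential u f) μ (darbouxWave f ψ) x t = laxA n u μ ψ x t
      - (tau f x t)⁻¹ * intX (fun y s => f y s * ψ y s) x t * laxA n u κ f x t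
      + f x t * intX (fun y s => f y s * ψ y s) x t * (tau f x t)⁻¹ ^ 2 * (h.flux n h.wave).1 x t
      - f x t * (tau f x t)⁻¹ * (h.flux n hψ).1 x t := by
  have key := congrArg (evalAt x t) (laxSeq_transformed (halfB_zero h.potElt)
    (halfB_recursion h.potElt) (Derivation.map_algebraMap _ κ)
    (h.wave.xDeriv_xDeriv h.potElt_apply) h.xDeriv_invElt (h.wave.xDeriv_intElt hψ hfψ)
    (h.wave.wronskian h.isOpen h.contDiff_u hψ hfψ) (d := halfB h.newPot) h.halfB_newPot
    isUnit_two (n + 1))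
  simp only [map_sub, map_add, map_mul, map_pow, evalAt_apply] at key
  change (laxSeq (xDeriv 𝕜) (halfB h.newPot) (algebraMap 𝕜 _ μ) (h.newWave hψ hfψ) (n + 1)).1 x t
    = _ at key
  rw [laxSeq_apply (fun y => h.newPot_apply y t ht) (fun y => h.newWave_apply hψ hfψ y ht),
    laxSeq_apply (fun y => h.potElt_apply y t ht) (fun y => h.wave.elt_apply y ht),
    laxSeq_apply (fun y => h.potElt_apply y t ht) (fun y => hψ.elt_apply y ht),
    h.wave.elt_apply x ht, h.invElt_apply x ht, intElt_apply _ _ hfψ x ht] at key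
  exact key

lemma darbouxSources_castSucc (j : Fin N) :
    darbouxSources f φ j.castSucc = darbouxWave f (φ j) := Fin.snoc_castSucc ..

lemma darbouxSources_last :
    darbouxSources f φ (Fin.last N) = fun x t => f x t / tau f x t := Fin.snoc_last ..

end TimeEvolution

section Main

variable {𝕜 : Type*} [RCLike 𝕜] {T : Set ℝ} {α κ μ : 𝕜} {u f ψ : ℝ → ℝ → 𝕜} {n N : ℕ}
  {lam : Fin N → 𝕜} {φ : Fin N → ℝ → ℝ → 𝕜}

/-- The transform of a solution of the Lax pair solves the transformed Lax pair. -/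
lemma isLaxSolution_darbouxWave (h : DarbouxSeed T κ u f) (hφ : ∀ j, IsWave T u (lam j) (φ j))
    (hlam : ∀ j, lam j ≠ κ)
    (hf : IsLaxSolution n N α (-α / 2) T u φ κ f) (hψ : IsLaxSolution n N α (-α / 2) T u φ μ ψ)
    (hfψ : ProductDecays T f ψ) :
    IsLaxSolution n (N + 1) α (-α / 2) T (darbouxPotential u f) (darbouxSources f φ) μ
      (darbouxWave f ψ) := by
  have hτ := smoothOn_tau h hφ hlam hf
  have hs := smoothOn_intX h hφ hlam hf hψ hfψ
  have hS : ∀ j, SmoothOn T (intX fun y s => f y s * φ j y s) := fun j =>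
    h.wave.smoothOn_intX_of_ne h.isOpen h.contDiff_u (hφ j) (hf.decay j).symm (hlam j).symm
  have hSf := smoothOn_intX h hφ hlam hf hf h.decay
  have hdj : ∀ j, ProductDecays T (darbouxWave f (φ j)) (darbouxWave f ψ) := fun j =>
    h.productDecays_darbouxWave (hφ j) hψ.wave (hψ.decay j) (hf.decay j).symm hfψ hτ (hS j) hs
  have hdf : ProductDecays T (darbouxWave f f) (darbouxWave f ψ) :=
    h.productDecays_darbouxWave h.wave hψ.wave hfψ h.decay hfψ hτ hSf hs
  refine ⟨h.smoothOn_darbouxWave hψ.smooth hτ hs, fun j => ?_,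
    h.darbouxWave_spectral hψ.wave hfψ, fun x t ht => ?_⟩
  · induction j using Fin.lastCases with
    | cast j => rw [darbouxSources_castSucc]; exact hdj j
    | last =>
      rw [darbouxSources_last]
      exact hdf.congr_left h.isOpen fun x t ht => (h.darbouxWave_self x ht).symm
  · have hτ0 := h.tau_ne x t ht
    have hD := (hψ.smooth.hasDerivAt_dt h.isOpen ht (x := x)).sub
      (((hf.smooth.hasDerivAt_dt h.isOpen ht (x := x)).div
        (hasDerivAt_tau_time h hφ hf x ht) hτ0).mul (hasDerivAt_intX_time h hφ hf hψ hfψ x ht))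
    have hdt : dt (darbouxWave f ψ) x t = _ := hD.deriv
    have hlast : intX (fun y s => f y s / tau f y s * darbouxWave f ψ y s) x t
        = intX (fun y s => f y s * ψ y s) x t / tau f x t := by
      have e1 : intX (fun y s => f y s / tau f y s * darbouxWave f ψ y s) x t
          = intX (fun y s => darbouxWave f f y s * darbouxWave f ψ y s) x t := by
        simp only [intX, h.darbouxWave_self _ ht]
      have e2 : intX (fun y s => f y s * f y s) x t = tau f x t - 1 := by rw [tau_eq]; ring
      rw [e1, h.intX_darbouxWave_mul hf.smooth hψ.smooth hfψ h.decay hfψ hdf x ht, e2]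
      field_simp
      ring
    rw [hdt, laxA_darbouxWave h hψ.wave hfψ x ht, Fin.sum_univ_castSucc]
    simp only [darbouxSources_castSucc, darbouxSources_last, Pi.div_apply, hlast,
      h.intX_darbouxWave_mul (hφ _).smooth hψ.smooth (hψ.decay _) (hf.decay _).symm hfψ (hdj _)
        x ht,
      hf.evolution x t ht, hψ.evolution x t ht]
    simp only [intX_mul_comm f (φ _)]
    have hsum : ∑ j, darbouxWave f (φ j) x t * (intX (fun y s => φ j y s * ψ y s) x t
          - intX (fun y s => φ j y s * f y s) x t * intX (fun y s => f y s * ψ y s) x t / tau f x t)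
        = ∑ j, φ j x t * intX (fun y s => φ j y s * ψ y s) x t
          - (intX (fun y s => f y s * ψ y s) x t / tau f x t)
            * ∑ j, φ j x t * intX (fun y s => φ j y s * f y s) x t
          - f x t / tau f x t * ∑ j, intX (fun y s => φ j y s * f y s) x t
            * intX (fun y s => φ j y s * ψ y s) x t
          + f x t * intX (fun y s => f y s * ψ y s) x t / tau f x t ^ 2
            * ∑ j, intX (fun y s => φ j y s * f y s) x t ^ 2 := by
      simp only [Finset.mul_sum, ← Finset.sum_sub_distrib, ← Finset.sum_add_distrib]
      refine Finset.sum_congr rfl fun j _ => ?_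
      rw [darbouxWave, intX_mul_comm f (φ j)]
      field_simp
      ring
    rw [hsum, darbouxWave]
    field_simp
    ring

/-- The evolution equation of the transformed potential: as `∂_t` commutes with `∂² ln`, the change
of `u_t` is `2 ∂²(τ_t / τ)`. -/
lemma darbouxPotential_evolution (h : DarbouxSeed T κ u f) (hφ : ∀ j, IsWave T u (lam j) (φ j))
    (hlam : ∀ j, lam j ≠ κ) (hf : IsLaxSolution n N α (-α / 2) T u φ κ f)
    (hsol : IsSourceSolution n N α T lam u φ) (x : ℝ) {t : ℝ} (ht : t ∈ T) :
    dt (darbouxPotential u f) x t =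
      dx (fun y s => -2 * evalDiff (bCoeff (n + 2)) (darbouxPotential u f) y s
        - 2 * α * ∑ j, darbouxSources f φ j y s ^ 2) x t := by
  have hT := h.isOpen
  have hτ := smoothOn_tau h hφ hlam hf
  set ℓ : ℝ → ℝ → 𝕜 := fun x t => dx (tau f) x t * (tau f x t)⁻¹ with hℓ
  set m : ℝ → ℝ → 𝕜 := fun x t => dt (tau f) x t * (tau f x t)⁻¹ with hm
  have hℓs : SmoothOn T ℓ := (hτ.dx hT).mul (hτ.inv h.tau_ne)
  have hms : SmoothOn T m := (hτ.dt hT).mul (hτ.inv h.tau_ne)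
  have hu : darbouxPotential u f = fun x t => u x t + 2 * dx ℓ x t := by
    funext x t
    simp only [darbouxPotential, dx, hℓ, ← div_eq_mul_inv]
    rfl
  -- the mixed second derivatives of `ln τ` agree
  have hswap : ∀ x, ∀ t ∈ T, dt ℓ x t = dx m x t := by
    intro x t ht
    have hτ0 := h.tau_ne x t ht
    have h1 : dt ℓ x t = _ := (((hτ.dx hT).hasDerivAt_dt hT ht (x := x)).mul
      ((hτ.hasDerivAt_dt hT ht (x := x)).inv hτ0)).deriv
    have h2 : dx m x t = _ := (((hτ.dt hT).hasDerivAt_dx hT ht (x := x)).mul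
      ((hτ.hasDerivAt_dx hT ht (x := x)).inv hτ0)).deriv
    rw [h1, h2, dt_dx_comm hT hτ ht]
    simp only [Pi.inv_apply]
    ring
  have hleft : dt (darbouxPotential u f) x t = dt u x t + 2 * dx (dx m) x t := by
    have h1 : dt (darbouxPotential u f) x t = dt u x t + 2 * dt (dx ℓ) x t := by
      rw [hu]
      exact ((h.smooth_u.hasDerivAt_dt hT ht).add
        (((hℓs.dx hT).hasDerivAt_dt hT ht).const_mul 2)).deriv
    rw [h1, dt_dx_comm hT hℓs ht, dx_congr hswap ht]
  have hpoint : ∀ y, -2 * evalDiff (bCoeff (n + 2)) (darbouxPotential u f) y t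
      - 2 * α * ∑ j, darbouxSources f φ j y t ^ 2
      = (-2 * evalDiff (bCoeff (n + 2)) u y t - 2 * α * ∑ j, φ j y t ^ 2) + 2 * dx m y t := by
    intro y
    have hτ0 := h.tau_ne y t ht
    have hb := congrArg (evalAt y t) (h.halfB_newPot (n + 1))
    rw [two_mul_halfB, two_mul_halfB, map_sub, evalAt_apply, evalAt_apply, evalAt_apply,
      evalSlice_apply (fun z => h.newPot_apply z t ht),
      evalSlice_apply (fun z => h.potElt_apply z t ht)] at hb
    have hmt : (fun z => m z t) = fun z => (h.flux n h.wave * h.invElt).1 z t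
        + (-α * (tau f z t - 1)
          + α * ∑ j, intX (fun y s => φ j y s * f y s) z t ^ 2) / tau f z t := by
      funext z
      have hτz := h.tau_ne z t ht
      change m z t = (h.flux n h.wave).1 z t * h.invElt.1 z t + _
      rw [hm, h.invElt_apply z ht]
      simp only
      rw [show dt (tau f) z t = _ from (hasDerivAt_tau_time h hφ hf z ht).deriv]
      ring
    have hS : HasDerivAt (fun z => ∑ j, intX (fun y s => φ j y s * f y s) z t ^ 2)
        (∑ j, 2 * intX (fun y s => φ j y s * f y s) y t * (φ j y t * f y t)) y :=
      HasDerivAt.fun_sum fun j _ => by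
        simpa using (hasDerivAt_intX_mul (hφ j).smooth hf.smooth (hf.decay j) y ht).fun_pow 2
    have hder := (hasDerivAt_slice (h.flux n h.wave * h.invElt) y t).add
      (((((h.hasDerivAt_tau y ht).sub_const 1).const_mul (-α)).add (hS.const_mul α)).div
        (h.hasDerivAt_tau y ht) hτ0)
    have hdm : dx m y t = _ := (congrArg (fun F : ℝ → 𝕜 => deriv F y) hmt).trans hder.deriv
    have hflux : (xDeriv 𝕜 (fluxSeq (xDeriv 𝕜) (halfB h.potElt) (algebraMap 𝕜 _ κ) h.wave.elt
        (algebraMap 𝕜 _ κ) h.wave.elt (n + 1) * h.invElt)).1 y t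
        = (xDeriv 𝕜 (h.flux n h.wave * h.invElt)).1 y t := rfl
    rw [hflux, show n + 1 + 1 = n + 2 from rfl] at hb
    rw [hdm, hb, Fin.sum_univ_castSucc]
    simp only [darbouxSources_castSucc, darbouxSources_last]
    have hsum : ∑ j, darbouxWave f (φ j) y t ^ 2 = ∑ j, φ j y t ^ 2
        - (tau f y t)⁻¹ * ∑ j, 2 * intX (fun y s => φ j y s * f y s) y t * (φ j y t * f y t)
        + (f y t / tau f y t) ^ 2 * ∑ j, intX (fun y s => φ j y s * f y s) y t ^ 2 := by
      simp only [Finset.mul_sum, ← Finset.sum_sub_distrib, ← Finset.sum_add_distrib]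
      refine Finset.sum_congr rfl fun j _ => ?_
      rw [darbouxWave, intX_mul_comm f (φ j)]
      field_simp
      ring
    rw [hsum]
    simp only [Pi.add_apply]
    generalize ∑ j, 2 * intX (fun y s => φ j y s * f y s) y t * (φ j y t * f y t) = Z
    field_simp
    ring
  have hY : DifferentiableAt ℝ (fun y => -2 * evalDiff (bCoeff (n + 2)) u y t
      - 2 * α * ∑ j, φ j y t ^ 2) x := by
    refine DifferentiableAt.sub ?_ ?_
    · simp only [← evalSlice_apply (fun z => h.potElt_apply z t ht)]
      exact (differentiableAt_slice _ t x).const_mul _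
    · exact (DifferentiableAt.fun_sum fun j _ =>
        ((hφ j).smooth.hasDerivAt_dx hT ht).differentiableAt.pow 2).const_mul _
  rw [hleft, hsol.evolution x t ht]
  refine Eq.trans ?_ (congrArg (fun F : ℝ → 𝕜 => deriv F x) (funext hpoint)).symm
  exact (hY.hasDerivAt.add (((hms.dx hT).hasDerivAt_dx hT ht).const_mul 2)).deriv.symm

end Main

end KdVSources

end

open KdVSources
theorem theorem4p3 {𝕜 : Type*} [RCLike 𝕜] (n N : ℕ) (α : 𝕜) (T : Set ℝ) (hT : IsOpen T)
    (lam : Fin (N + 1) → 𝕜) (hlam : Function.Injective lam)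
    (u : ℝ → ℝ → 𝕜) (φ : Fin N → ℝ → ℝ → 𝕜) (f : ℝ → ℝ → 𝕜)
    (hu : BoundedAtNegInf T u)
    (hsol : IsSourceSolution n N α T (fun j : Fin N => lam j.castSucc) u φ)
    (hf : IsLaxSolution n N α (-α / 2) T u φ (lam (Fin.last N)) f)
    (hff : ProductDecays T f f)
    (hτ : ∀ x, ∀ t ∈ T, tau f x t ≠ 0) :
    (∀ (μ : 𝕜) (ψ : ℝ → ℝ → 𝕜),
      IsLaxSolution n N α (-α / 2) T u φ μ ψ → ProductDecays T f ψ →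
      IsLaxSolution n (N + 1) α (-α / 2) T (darbouxPotential u f) (darbouxSources f φ) μ
        (darbouxWave f ψ)) ∧
    IsSourceSolution n (N + 1) α T lam (darbouxPotential u f) (darbouxSources f φ) ∧
    BoundedAtNegInf T (darbouxPotential u f) := by
  have h : DarbouxSeed T (lam (Fin.last N)) u f := ⟨hT, hsol.smooth_u, hu, hf.wave, hff, hτ⟩
  have hφ : ∀ j : Fin N, IsWave T u (lam j.castSucc) (φ j) := fun j =>
    ⟨hsol.smooth_φ j, hsol.spectral j⟩
  have hne : ∀ j : Fin N, lam j.castSucc ≠ lam (Fin.last N) := fun j =>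
    hlam.ne (Fin.castSucc_lt_last j).ne
  have hτs := smoothOn_tau h hφ hne hf
  refine ⟨fun μ ψ hψ hfψ => isLaxSolution_darbouxWave h hφ hne hf hψ hfψ,
    ⟨h.smoothOn_darbouxPotential hτs, fun j => ?_,
      fun x t ht => darbouxPotential_evolution h hφ hne hf hsol x ht, fun j => ?_⟩,
    h.boundedAtNegInf_darbouxPotential hτs⟩
  · induction j using Fin.lastCases with
    | cast j =>
      rw [darbouxSources_castSucc]
      exact h.smoothOn_darbouxWave (hsol.smooth_φ j) hτs (h.wave.smoothOn_intX_of_ne hT h.contDiff_u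
        (hφ j) (hf.decay j).symm (hne j).symm)
    | last =>
      rw [darbouxSources_last]
      exact (hf.smooth.mul (hτs.inv hτ)).congr fun x t _ => div_eq_mul_inv _ _
  · induction j using Fin.lastCases with
    | cast j =>
      rw [darbouxSources_castSucc]
      exact h.darbouxWave_spectral (hφ j) (hf.decay j).symm
    | last =>
      intro x t ht
      have h1 := h.darbouxWave_spectral hf.wave hff x t ht
      have e : ∀ y, ∀ s ∈ T, f y s / tau f y s = darbouxWave f f y s := fun y s hs =>
        (h.darbouxWave_self y hs).symm
      rw [darbouxSources_last]
      rw [dx_congr (fun y s hs => dx_congr e hs) ht]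
      simp only [e x t ht]
      exact h1
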